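/- An index is a finite, possibly empty, sequence $\boldsymbol{k}=(k_1,\ldots,k_r)$ of positive integers; $\mathrm{dep}(\boldsymbol{k})=r$ is its depth and $\mathrm{wt}(\boldsymbol{k})=k_1+\cdots+k_r$ its weight. Let $\mathcal{I}$ be the set of all indices. For $\boldsymbol{k}=(k_1,\ldots,k_r)$ and $\boldsymbol{l}=(l_1,\ldots,l_s)$ in $\mathcal{I}$ and an integer $a\ge 2$, the anti-hook $t$-multiple zeta value at $t=1/2$ is $$\zeta^{\frac12}\Bigl(\binom{\boldsymbol{k}}{\boldsymbol{l}};a\Bigr) := \lim_{N\to\infty}\ \sum_{\substack{1\le m_1\le\cdots\le m_r\le q\le N\\ 1\le n_1\le\cdots\le n_s\le q\le N}} \frac{t^{\,r+1-\#\{m_1,\ldots,m_r,q\}}}{m_1^{k_1}\cdots m_r^{k_r}}\,\frac{1}{q^a}\,\frac{(1-t)^{\,s+1-\#\{n_1,\ldots,n_s,q\}}}{n_1^{l_1}\cdots n_s^{l_s}}\Biggr|_{t=1/2}.$$ Let $$G^{\frac12}_{\mathrm{wtd}}(A,B,W) := \sum_{\substack{\boldsymbol{k},\boldsymbol{l}\in\mathcal{I}\\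 a\ge 2}} (2^{a-2}-1)\,\zeta^{\frac12}\Bigl(\binom{\boldsymbol{k}}{\boldsymbol{l}};a\Bigr)\,A^{\mathrm{dep}(\boldsymbol{k})}B^{\mathrm{dep}(\boldsymbol{l})}W^{\mathrm{wt}(\boldsymbol{k})+a+\mathrm{wt}(\boldsymbol{l})}\in\mathbb{R}[[A,B,W]],\qquad \psi_1(X):=\sum_{k\ge 2}\zeta(k)X^{k-1}\in\mathbb{R}[[X]],$$ where $\zeta(k)$ is the Riemann zeta value. **Proposition.** All the limits above exist, and in $\mathbb{R}[[A,B,W]]$ $$G^{\frac12}_{\mathrm{wtd}}(A,B,W)=\frac{W}{2\left(1-\frac A2\right)\left(1-\frac B2\right)}\left\{\psi_1(2W)+\psi_1\!\left(\frac{A+B}{2}W\right)-\psi_1\!\left(\Bigl(1+\frac A2\Bigr)W\right)-\psi_1\!\left(\Bigl(1+\frac B2\Bigr)W\right)\right\}.$$ -/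

import Mathlib

open scoped BigOperators

noncomputable section

namespace AntiHook

/-- An index: a finite (possibly empty) sequence of positive integers. -/
abbrev Index : Type := List ℕ+

/-- The weight `k₁ + ⋯ + k_r` of an index; its depth `r` is `k.length`. -/
def wt (k : Index) : ℕ := (k.map (fun x : ℕ+ => (x : ℕ))).sum

/-- The weakly increasing sequences `1 ≤ m₁ ≤ ⋯ ≤ m_r ≤ q` of integers. -/
def chains (r q : ℕ) : Finset (Fin r → ℕ) :=
  open Classical in
  (Fintype.piFinset fun _ : Fin r => Finset.Icc 1 q).filter fun m => Monotone m

/-- The number of distinct integers in `{m₁, …, m_r, q}`. -/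
def numDistinct {r : ℕ} (m : Fin r → ℕ) (q : ℕ) : ℕ :=
  (insert q (Finset.univ.image m)).card

/-- The contribution
`t ^ (r + 1 - #{m₁, …, m_r, q}) / (m₁ ^ k₁ ⋯ m_r ^ k_r)` of one arm to a summand of the
truncated interpolated anti-hook sum. -/
def armWeight (t : ℝ) (k : Index) (m : Fin k.length → ℕ) (q : ℕ) : ℝ :=
  t ^ (k.length + 1 - numDistinct m q) / ∏ i : Fin k.length, (m i : ℝ) ^ ((k.get i : ℕ+) : ℕ)

/-- The truncated anti-hook `t`-sum: the sum over `1 ≤ m₁ ≤ ⋯ ≤ m_r ≤ q ≤ N` and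
`1 ≤ n₁ ≤ ⋯ ≤ n_s ≤ q ≤ N`, where the arm `k` is weighted with `t` and the arm `l`
with `1 - t`. -/
def zetaTrunc (t : ℝ) (k l : Index) (a N : ℕ) : ℝ :=
  ∑ q ∈ Finset.Icc 1 N, ∑ m ∈ chains k.length q, ∑ n ∈ chains l.length q,
    armWeight t k m q * (1 / (q : ℝ) ^ a) * armWeight (1 - t) l n q

/-- The anti-hook `t`-multiple zeta value: the limit of the truncated sums as `N → ∞`. -/
def zeta (t : ℝ) (k l : Index) (a : ℕ) : ℝ :=
  Filter.limUnder Filter.atTop (zetaTrunc t k l a)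

/-- Formal power series over `ℝ` in the three indeterminates `A`, `B`, `W`. -/
abbrev Series : Type := MvPowerSeries (Fin 3) ℝ

/-- The indeterminate `A`. -/
def A : Series := MvPowerSeries.X 0

/-- The indeterminate `B`. -/
def B : Series := MvPowerSeries.X 1

/-- The indeterminate `W`. -/
def W : Series := MvPowerSeries.X 2

/-- The summand `(2^(a-2) - 1) ζ^{1/2}(k; l; a) A^{dep k} B^{dep l} W^{wt k + a + wt l}`
(used for `a ≥ 2`). -/
def term (p : Index × Index × {a : ℕ // 2 ≤ a}) : Series :=
  MvPowerSeries.C (((2 : ℝ) ^ ((p.2.2 : ℕ) - 2) - 1) * zeta (1 / 2) p.1 p.2.1 p.2.2) *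
    A ^ p.1.length * B ^ p.2.1.length * W ^ (wt p.1 + (p.2.2 : ℕ) + wt p.2.1)

/-- The generating function `G^{1/2}_wtd(A, B, W)`: the formal sum of all `term`s, computed
coefficientwise. Every coefficient is a finite sum, see `finite_support_coeff_term`. -/
def G : Series := fun d => ∑ᶠ p : Index × Index × {a : ℕ // 2 ≤ a}, MvPowerSeries.coeff d (term p)

lemma finite_setOf_wt_le (r w : ℕ) : {k : Index | k.length = r ∧ wt k ≤ w}.Finite := by
  have hs : {x : ℕ+ | (x : ℕ) ≤ w}.Finite :=
    (Set.finite_Iic w).preimage PNat.coe_injective.injOn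
  have : Finite {x : ℕ+ // (x : ℕ) ≤ w} := hs.to_subtype
  refine ((List.finite_length_eq {x : ℕ+ // (x : ℕ) ≤ w} r).image
    (List.map Subtype.val)).subset ?_
  rintro k ⟨hk, hw⟩
  have hx : ∀ x ∈ k, ((x : ℕ+) : ℕ) ≤ w := fun x hx =>
    (List.single_le_sum (fun _ _ => Nat.zero_le _) _
      (List.mem_map_of_mem (f := fun x : ℕ+ => (x : ℕ)) hx)).trans hw
  exact ⟨k.attach.map fun x => ⟨x.1, hx x.1 x.2⟩, by simp [hk], by simp⟩

lemma term_eq_monomial (p : Index × Index × {a : ℕ // 2 ≤ a}) :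
    term p = MvPowerSeries.monomial
      (Finsupp.single 0 p.1.length + Finsupp.single 1 p.2.1.length +
        Finsupp.single 2 (wt p.1 + (p.2.2 : ℕ) + wt p.2.1))
      (((2 : ℝ) ^ ((p.2.2 : ℕ) - 2) - 1) * zeta (1 / 2) p.1 p.2.1 p.2.2) := by
  rw [term, A, B, W, MvPowerSeries.X_pow_eq, MvPowerSeries.X_pow_eq, MvPowerSeries.X_pow_eq,
    ← MvPowerSeries.monomial_zero_eq_C_apply, MvPowerSeries.monomial_mul_monomial,
    MvPowerSeries.monomial_mul_monomial, MvPowerSeries.monomial_mul_monomial]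
  simp only [zero_add, mul_one]

/-- Only finitely many terms contribute to a given coefficient of `G`. -/
lemma finite_support_coeff_term (d : Fin 3 →₀ ℕ) :
    (Function.support fun p => MvPowerSeries.coeff d (term p)).Finite := by
  classical
  have ha : {a : {a : ℕ // 2 ≤ a} | (a : ℕ) ≤ d 2}.Finite :=
    (Set.finite_Iic (d 2)).preimage Subtype.val_injective.injOn
  refine ((finite_setOf_wt_le (d 0) (d 2)).prod
    ((finite_setOf_wt_le (d 1) (d 2)).prod ha)).subset ?_
  rintro ⟨k, l, a⟩ h
  rw [Function.mem_support, term_eq_monomial, MvPowerSeries.coeff_monomial] at h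
  have hd := (ite_ne_right_iff.1 h).1
  have h0 : d 0 = k.length := by rw [hd]; simp
  have h1 : d 1 = l.length := by rw [hd]; simp
  have h2 : d 2 = wt k + (a : ℕ) + wt l := by rw [hd]; simp
  simp only [Set.mem_prod, Set.mem_ofPred_eq]
  omega

/-- The power series `ψ₁(X) = ∑_{k ≥ 2} ζ(k) X^(k-1)`, i.e. `ψ₁(X) = -ψ(1 - X) - γ` for the
digamma function `ψ`. -/
def psiOne : PowerSeries ℝ :=
  PowerSeries.mk fun n => if n = 0 then 0 else (riemannZeta ((n + 1 : ℕ) : ℂ)).re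

/-- The composite `ψ₁(f)` of `ψ₁` with a power series `f` without constant term. -/
def psiOneAt (f : Series) : Series := PowerSeries.subst f psiOne

end AntiHook

end

/-!
The proof computes the generating function truncated at `q ≤ N` and transforms it by a telescoping
(WZ) argument before letting `N → ∞`.

*Arms.* For a fixed corner `q`, removing the largest entry of an arm gives a recursion for its
generating function `E_q` (`armSeries_eq`). At `t = 1 / 2`, with `α = A W / 2`, its solution is
`E_q = (q - W) / (q - W - α) * ∏_{j < q} (j - W + α) / (j - W - α)` (`armSeries_half`); the other
arm is the same with `β = B W / 2`. The weights `2 ^ (a - 2) - 1` sum over `a` to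
`W ^ 3 / (q (q - 2 W) (q - W))`. Hence the truncation `truncG N` of `G` is `W ^ 3` times
`∑_{q ≤ N} (q - W) / (q (q - 2 W) (q - W - α) (q - W - β)) *
  ∏_{j < q} (j - W + α) (j - W + β) / ((j - W - α) (j - W - β))`,
a well-poised hypergeometric sum (`truncG_eq`).

*Telescoping.* Replace `W, α, β` by `W - s / 2, α - s / 2, β - s / 2`, and let `wpTerm s q` be twice
the resulting summand. Then
`wpTerm s q - wpTerm (s + 1) q = wpCert s q - wpCert s (q + 1)` with an explicit `wpCert`
(`wpTerm_sub_wpTerm`). So the sum of `wpTerm 0 q` over `q ≤ N` is the sum of `wpCert s 1` over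
`s < N`, up to two remainders. Writing `n = s + 1`, partial fractions give
`(W - α) (W - β) wpCert s 1 =
  1 / (n - 2 W) + 1 / (n - α - β) - 1 / (n - W - α) - 1 / (n - W - β)` (`mul_wpCert_one`), and the
expansion `ψ₁(X) = ∑_n (1 / (n - X) - 1 / n)` produces the right-hand side.

*Limits.* All limits of power series are coefficientwise. The remainders tend to zero because they
do so in `truncNorm`, a submultiplicative norm controlling the coefficients up to a given exponent
(`tendsto_sum_wpTerm_sub`). Each truncated anti-hook sum converges because an arm of depth `r` is
at most `(1 + log q) ^ r`.
-/

open scoped BigOperators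

noncomputable section

namespace AntiHook

/-! ### A truncated weighted norm on power series -/

/-- The `ℓ¹`-norm of the coefficients of exponent at most `D`, where the monomial
`A ^ i * B ^ j * W ^ k` has norm `(1 / 40) ^ k`. The truncation at `D` makes it finite on all of
`Series` while keeping it submultiplicative. -/
def truncNorm (D : Fin 3 →₀ ℕ) (f : Series) : ℝ :=
  ∑ d ∈ Finset.Iic D, |MvPowerSeries.coeff d f| * (1 / 40 : ℝ) ^ d 2

variable {D : Fin 3 →₀ ℕ} {f g : Series}

lemma truncNorm_nonneg : 0 ≤ truncNorm D f := Finset.sum_nonneg fun _ _ => by positivity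

lemma abs_coeff_le_truncNorm : |MvPowerSeries.coeff D f| ≤ 40 ^ D 2 * truncNorm D f := by
  have h : |MvPowerSeries.coeff D f| * (1 / 40 : ℝ) ^ D 2 ≤ truncNorm D f :=
    Finset.single_le_sum (f := fun d => |MvPowerSeries.coeff d f| * (1 / 40 : ℝ) ^ d 2)
      (fun _ _ => by positivity) (Finset.mem_Iic.2 le_rfl)
  calc |MvPowerSeries.coeff D f|
      = 40 ^ D 2 * (|MvPowerSeries.coeff D f| * (1 / 40 : ℝ) ^ D 2) := by
        rw [one_div, inv_pow]; field_simp
    _ ≤ _ := by gcongr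

lemma truncNorm_add_le : truncNorm D (f + g) ≤ truncNorm D f + truncNorm D g := by
  rw [truncNorm, truncNorm, truncNorm, ← Finset.sum_add_distrib]
  refine Finset.sum_le_sum fun d _ => ?_
  rw [map_add, ← add_mul]
  gcongr
  exact abs_add_le _ _

lemma truncNorm_neg : truncNorm D (-f) = truncNorm D f := by
  simp only [truncNorm, map_neg, abs_neg]

lemma truncNorm_sub_le : truncNorm D (f - g) ≤ truncNorm D f + truncNorm D g := by
  rw [sub_eq_add_neg, ← truncNorm_neg (f := g)]
  exact truncNorm_add_le

lemma truncNorm_sum_le {ι : Type*} (s : Finset ι) (F : ι → Series) :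
    truncNorm D (∑ i ∈ s, F i) ≤ ∑ i ∈ s, truncNorm D (F i) := by
  classical
  induction s using Finset.induction_on with
  | empty => simp [truncNorm]
  | insert i s hi ih =>
    rw [Finset.sum_insert hi, Finset.sum_insert hi]
    exact truncNorm_add_le.trans (by gcongr)

lemma truncNorm_mul_le : truncNorm D (f * g) ≤ truncNorm D f * truncNorm D g := by
  classical
  set w : (Fin 3 →₀ ℕ) → Series → ℝ := fun d h => |MvPowerSeries.coeff d h| * (1 / 40 : ℝ) ^ d 2
  have hw : ∀ d h, 0 ≤ w d h := fun d h => by positivity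
  calc truncNorm D (f * g)
      ≤ ∑ d ∈ Finset.Iic D, ∑ p ∈ Finset.HasAntidiagonal.antidiagonal d, w p.1 f * w p.2 g := by
        refine Finset.sum_le_sum fun d _ => ?_
        rw [MvPowerSeries.coeff_mul]
        refine (mul_le_mul_of_nonneg_right (Finset.abs_sum_le_sum_abs _ _) (by positivity)).trans ?_
        rw [Finset.sum_mul]
        refine Finset.sum_le_sum fun p hp => le_of_eq ?_
        rw [← Finset.HasAntidiagonal.mem_antidiagonal.1 hp, abs_mul, Finsupp.add_apply, pow_add]
        ring
    _ = ∑ x ∈ (Finset.Iic D).sigma fun d => Finset.HasAntidiagonal.antidiagonal d,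
          w x.2.1 f * w x.2.2 g := by rw [Finset.sum_sigma]
    _ = ∑ p ∈ ((Finset.Iic D).sigma fun d => Finset.HasAntidiagonal.antidiagonal d).image (fun x => x.2),
          w p.1 f * w p.2 g := by
        rw [Finset.sum_image]
        rintro ⟨d, p⟩ hx ⟨e, q⟩ hy h
        simp only [Finset.coe_sigma, Set.mem_sigma_iff, Finset.mem_coe,
          Finset.HasAntidiagonal.mem_antidiagonal] at hx hy h
        subst h
        obtain rfl : d = e := hx.2.symm.trans hy.2
        rfl
    _ ≤ ∑ p ∈ Finset.Iic D ×ˢ Finset.Iic D, w p.1 f * w p.2 g := by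
        refine Finset.sum_le_sum_of_subset_of_nonneg ?_ fun p _ _ => mul_nonneg (hw _ _) (hw _ _)
        intro p hp
        obtain ⟨⟨d, q⟩, hx, rfl⟩ := Finset.mem_image.1 hp
        simp only [Finset.mem_sigma, Finset.mem_Iic, Finset.HasAntidiagonal.mem_antidiagonal] at hx
        simp only [Finset.mem_product, Finset.mem_Iic]
        exact ⟨(hx.2 ▸ le_self_add).trans hx.1, (hx.2 ▸ le_add_self).trans hx.1⟩
    _ = truncNorm D f * truncNorm D g := by
        rw [Finset.sum_product, truncNorm, truncNorm, Finset.sum_mul_sum]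

lemma truncNorm_mul_le_of_le {x y : ℝ} (hf : truncNorm D f ≤ x) (hg : truncNorm D g ≤ y) :
    truncNorm D (f * g) ≤ x * y :=
  truncNorm_mul_le.trans (mul_le_mul hf hg truncNorm_nonneg (truncNorm_nonneg.trans hf))

lemma truncNorm_monomial_le (d : Fin 3 →₀ ℕ) (c : ℝ) :
    truncNorm D (MvPowerSeries.monomial d c) ≤ |c| * (1 / 40 : ℝ) ^ d 2 := by
  classical
  simp only [truncNorm, MvPowerSeries.coeff_monomial]
  calc _ ≤ ∑ e ∈ Finset.Iic D, if e = d then |c| * (1 / 40 : ℝ) ^ d 2 else 0 := by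
        refine Finset.sum_le_sum fun e _ => ?_
        split_ifs with h
        · rw [h]
        · simp
    _ ≤ _ := by
        rw [Finset.sum_ite_eq']
        split_ifs
        · exact le_rfl
        · positivity

lemma truncNorm_C_le (c : ℝ) : truncNorm D (MvPowerSeries.C c) ≤ |c| := by
  simpa using truncNorm_monomial_le (D := D) 0 c

lemma truncNorm_A_le : truncNorm D A ≤ 1 := by
  refine (truncNorm_monomial_le (D := D) (Finsupp.single 0 1) 1).trans ?_
  simp

lemma truncNorm_B_le : truncNorm D B ≤ 1 := by
  refine (truncNorm_monomial_le (D := D) (Finsupp.single 1 1) 1).trans ?_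
  simp

lemma truncNorm_W_le : truncNorm D W ≤ 1 / 40 := by
  refine (truncNorm_monomial_le (D := D) (Finsupp.single 2 1) 1).trans ?_
  norm_num

lemma truncNorm_one_le : truncNorm D (1 : Series) ≤ 1 := by
  simpa using truncNorm_C_le (D := D) 1

lemma abs_constantCoeff_le_truncNorm : |MvPowerSeries.constantCoeff f| ≤ truncNorm D f := by
  have := Finset.single_le_sum (f := fun d => |MvPowerSeries.coeff d f| * (1 / 40 : ℝ) ^ d 2)
      (fun _ _ => by positivity) (Finset.mem_Iic.2 (zero_le : 0 ≤ D))
  simpa [truncNorm] using this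

/-- The geometric series bound. It follows from `c f⁻¹ = 1 + (c - f) f⁻¹`, the norm being finite. -/
lemma truncNorm_inv_le {c δ : ℝ} (h : truncNorm D (f - MvPowerSeries.C c) ≤ δ) (hc : δ < c) :
    truncNorm D f⁻¹ ≤ 1 / (c - δ) := by
  have hδ : 0 ≤ δ := truncNorm_nonneg.trans h
  have hc0 : 0 < c := hδ.trans_lt hc
  have h0 : MvPowerSeries.constantCoeff f ≠ 0 := by
    intro h0
    have := (abs_constantCoeff_le_truncNorm (D := D) (f := f - MvPowerSeries.C c)).trans h
    rw [map_sub, h0, MvPowerSeries.constantCoeff_C, zero_sub, abs_neg, abs_of_pos hc0] at this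
    linarith
  have hinv : f⁻¹ = MvPowerSeries.C c⁻¹ * (1 - (f - MvPowerSeries.C c) * f⁻¹) := by
    have h1 := MvPowerSeries.mul_inv_cancel f h0
    have h2 : (MvPowerSeries.C c⁻¹ : Series) * MvPowerSeries.C c = 1 := by
      rw [← map_mul, inv_mul_cancel₀ hc0.ne', map_one]
    linear_combination MvPowerSeries.C c⁻¹ * h1 + (-f⁻¹) * h2
  have h3 : truncNorm D f⁻¹ ≤ c⁻¹ * (1 + δ * truncNorm D f⁻¹) := by
    conv_lhs => rw [hinv]
    refine truncNorm_mul_le_of_le ((truncNorm_C_le _).trans_eq (abs_of_pos (by positivity))) ?_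
    exact truncNorm_sub_le.trans (add_le_add truncNorm_one_le (truncNorm_mul_le_of_le h le_rfl))
  rw [le_div_iff₀ (by linarith)]
  have h4 := mul_le_mul_of_nonneg_left h3 hc0.le
  rw [mul_inv_cancel_left₀ hc0.ne'] at h4
  linarith

/-! ### A telescoping family of well-poised sums -/

section WellPoised

variable {K : Type*} [CommRing K] [Inv K]

/-- The product over `1 ≤ j < q` in the `q`-th term of the well-poised sum with shift `s`. Only
`CommRing` and `Inv` are assumed, to cover power series as well as their fraction field. -/
def wpProd (w a b : K) (s q : ℕ) : K :=
  ∏ j ∈ Finset.Ico 1 q,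
    (((j : K) - w + a) * ((j : K) - w + b) * ((j : K) + s - w - a)⁻¹ * ((j : K) + s - w - b)⁻¹)

/-- The `q`-th term of the well-poised sum with shift `s`: the term
`2 (q - w) / (q (q - 2 w) (q - w - a) (q - w - b)) * wpProd w a b 0 q` with `w, a, b` lowered by
`s / 2`. -/
def wpTerm (w a b : K) (s q : ℕ) : K :=
  (2 * (q : K) + s - 2 * w) * (q : K)⁻¹ * ((q : K) + s - 2 * w)⁻¹ * ((q : K) + s - w - a)⁻¹ *
    ((q : K) + s - w - b)⁻¹ * wpProd w a b s q

/-- The telescoping certificate: its differences in `q` are the differences of `wpTerm` in `s`. -/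
def wpCert (w a b : K) (s q : ℕ) : K :=
  ((q : K) + 1 + 2 * s - 2 * w - a - b) * ((s : K) + 1 - a - b)⁻¹ * ((q : K) + s - 2 * w)⁻¹ *
    ((q : K) + s - w - a)⁻¹ * ((q : K) + s - w - b)⁻¹ * wpProd w a b s q

lemma wpProd_succ (w a b : K) (s : ℕ) {q : ℕ} (hq : 1 ≤ q) :
    wpProd w a b s (q + 1) = wpProd w a b s q *
      (((q : K) - w + a) * ((q : K) - w + b) * ((q : K) + s - w - a)⁻¹ *
        ((q : K) + s - w - b)⁻¹) :=
  Finset.prod_Ico_succ_top hq _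

end WellPoised

section WellPoisedField

variable {K : Type*} [Field K] {w a b : K}

lemma wpProd_shift (ha : ∀ n : ℕ, 1 ≤ n → (n : K) - w - a ≠ 0)
    (hb : ∀ n : ℕ, 1 ≤ n → (n : K) - w - b ≠ 0) (s : ℕ) {q : ℕ} (hq : 1 ≤ q) :
    wpProd w a b (s + 1) q = wpProd w a b s q *
      (((s : K) + 1 - w - a) * ((s : K) + 1 - w - b) * ((q : K) + s - w - a)⁻¹ *
        ((q : K) + s - w - b)⁻¹) := by
  induction q, hq using Nat.le_induction with
  | base =>
    have h1 := ha (s + 1) (by omega)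
    have h2 := hb (s + 1) (by omega)
    push_cast at h1 h2
    simp only [wpProd, Finset.Ico_self, Finset.prod_empty, Nat.cast_one, one_mul]
    rw [add_comm (1 : K)]
    field_simp
  | succ q hq ih =>
    have h1 := ha (q + s) (by omega)
    have h2 := hb (q + s) (by omega)
    have h3 := ha (q + s + 1) (by omega)
    have h4 := hb (q + s + 1) (by omega)
    push_cast at h1 h2 h3 h4
    rw [wpProd_succ _ _ _ _ hq, wpProd_succ _ _ _ _ hq, ih]
    push_cast
    rw [show (q : K) + (s + 1) - w - a = q + s + 1 - w - a by ring,
      show (q : K) + (s + 1) - w - b = q + s + 1 - w - b by ring,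
      show (q : K) + 1 + s - w - a = q + s + 1 - w - a by ring,
      show (q : K) + 1 + s - w - b = q + s + 1 - w - b by ring]
    field_simp

lemma wpTerm_sub_wpTerm (h0 : ∀ n : ℕ, 1 ≤ n → (n : K) ≠ 0)
    (hw : ∀ n : ℕ, 1 ≤ n → (n : K) - 2 * w ≠ 0)
    (ha : ∀ n : ℕ, 1 ≤ n → (n : K) - w - a ≠ 0) (hb : ∀ n : ℕ, 1 ≤ n → (n : K) - w - b ≠ 0)
    (hab : ∀ n : ℕ, 1 ≤ n → (n : K) - a - b ≠ 0) (s : ℕ) {q : ℕ} (hq : 1 ≤ q) :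
    wpTerm w a b s q - wpTerm w a b (s + 1) q = wpCert w a b s q - wpCert w a b s (q + 1) := by
  have h1 := ha (q + s) (by omega)
  have h2 := hb (q + s) (by omega)
  have h3 := ha (q + s + 1) (by omega)
  have h4 := hb (q + s + 1) (by omega)
  have h5 := hw (q + s) (by omega)
  have h6 := hw (q + s + 1) (by omega)
  have h7 := hab (s + 1) (by omega)
  have h8 := h0 q hq
  push_cast at h1 h2 h3 h4 h5 h6 h7
  simp only [wpTerm, wpCert]
  rw [wpProd_shift ha hb s hq, wpProd_succ _ _ _ _ hq]
  push_cast
  rw [show (q : K) + (s + 1) - w - a = q + s + 1 - w - a by ring,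
    show (q : K) + (s + 1) - w - b = q + s + 1 - w - b by ring,
    show (q : K) + (s + 1) - 2 * w = q + s + 1 - 2 * w by ring,
    show (q : K) + 1 + s - w - a = q + s + 1 - w - a by ring,
    show (q : K) + 1 + s - w - b = q + s + 1 - w - b by ring,
    show (q : K) + 1 + s - 2 * w = q + s + 1 - 2 * w by ring]
  field_simp
  ring

/-- The telescoping relation summed over `q ≤ N` and over the shifts `s < M`. -/
lemma sum_wpTerm (h0 : ∀ n : ℕ, 1 ≤ n → (n : K) ≠ 0)
    (hw : ∀ n : ℕ, 1 ≤ n → (n : K) - 2 * w ≠ 0)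
    (ha : ∀ n : ℕ, 1 ≤ n → (n : K) - w - a ≠ 0) (hb : ∀ n : ℕ, 1 ≤ n → (n : K) - w - b ≠ 0)
    (hab : ∀ n : ℕ, 1 ≤ n → (n : K) - a - b ≠ 0) (M N : ℕ) :
    ∑ q ∈ Finset.Ico 1 (N + 1), wpTerm w a b 0 q =
      ∑ s ∈ Finset.range M, wpCert w a b s 1 + ∑ q ∈ Finset.Ico 1 (N + 1), wpTerm w a b M q -
        ∑ s ∈ Finset.range M, wpCert w a b s (N + 1) := by
  induction M with
  | zero => simp
  | succ M ih =>
    have h : ∑ q ∈ Finset.Ico 1 (N + 1), wpTerm w a b M q -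
        ∑ q ∈ Finset.Ico 1 (N + 1), wpTerm w a b (M + 1) q =
        wpCert w a b M 1 - wpCert w a b M (N + 1) := by
      rw [← Finset.sum_sub_distrib, ← neg_sub (wpCert w a b M (N + 1)),
        ← Finset.sum_Ico_sub (wpCert w a b M) (by omega : 1 ≤ N + 1), ← Finset.sum_neg_distrib]
      refine Finset.sum_congr rfl fun q hq => ?_
      rw [wpTerm_sub_wpTerm h0 hw ha hb hab M (Finset.mem_Ico.1 hq).1, neg_sub]
    rw [ih, Finset.sum_range_succ, Finset.sum_range_succ]
    linear_combination h

/-- The partial fraction decomposition of the boundary terms `wpCert w a b s 1`. -/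
lemma mul_wpCert_one (hw : ∀ n : ℕ, 1 ≤ n → (n : K) - 2 * w ≠ 0)
    (ha : ∀ n : ℕ, 1 ≤ n → (n : K) - w - a ≠ 0) (hb : ∀ n : ℕ, 1 ≤ n → (n : K) - w - b ≠ 0)
    (hab : ∀ n : ℕ, 1 ≤ n → (n : K) - a - b ≠ 0) (s : ℕ) :
    (w - a) * (w - b) * wpCert w a b s 1 =
      ((s : K) + 1 - 2 * w)⁻¹ + ((s : K) + 1 - a - b)⁻¹ - ((s : K) + 1 - w - a)⁻¹ -
        ((s : K) + 1 - w - b)⁻¹ := by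
  have h1 := ha (s + 1) (by omega)
  have h2 := hb (s + 1) (by omega)
  have h5 := hw (s + 1) (by omega)
  have h7 := hab (s + 1) (by omega)
  push_cast at h1 h2 h5 h7
  simp only [wpCert, wpProd, Finset.Ico_self, Finset.prod_empty, Nat.cast_one, mul_one]
  rw [add_comm (1 : K) (s : K)]
  obtain ⟨x, hx⟩ : ∃ x, x = (s : K) + 1 - 2 * w := ⟨_, rfl⟩
  obtain ⟨y, hy⟩ : ∃ y, y = (s : K) + 1 - a - b := ⟨_, rfl⟩
  obtain ⟨u, hu⟩ : ∃ u, u = (s : K) + 1 - w - a := ⟨_, rfl⟩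
  obtain ⟨v, hv⟩ : ∃ v, v = (s : K) + 1 - w - b := ⟨_, rfl⟩
  rw [← hx, ← hy, ← hu, ← hv]
  rw [← hx] at h5
  rw [← hy] at h7
  rw [← hu] at h1
  rw [← hv] at h2
  field_simp
  rw [hx, hy, hu, hv]
  ring

end WellPoisedField

/-! ### Transformation of the well-poised sum over power series -/

section Transformation

open Filter Topology
open scoped MvPowerSeries.WithPiTopology

lemma map_inv_of_constantCoeff_ne_zero {K : Type*} [Field K] (φ : Series →+* K) {f : Series}
    (hf : MvPowerSeries.constantCoeff f ≠ 0) : φ f⁻¹ = (φ f)⁻¹ := by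
  refine eq_inv_of_mul_eq_one_left ?_
  rw [← map_mul, MvPowerSeries.inv_mul_cancel f hf, map_one]

section Map

variable {K : Type*} [Field K] (φ : Series →+* K) {w a b : Series}

lemma map_wpProd (hw : MvPowerSeries.constantCoeff w = 0) (ha : MvPowerSeries.constantCoeff a = 0)
    (hb : MvPowerSeries.constantCoeff b = 0) (s q : ℕ) :
    φ (wpProd w a b s q) = wpProd (φ w) (φ a) (φ b) s q := by
  simp only [wpProd, map_prod]
  refine Finset.prod_congr rfl fun j hj => ?_
  have h : ((j : ℝ) + s) ≠ 0 := by
    have := (Finset.mem_Ico.1 hj).1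
    positivity
  simp only [map_mul]
  rw [map_inv_of_constantCoeff_ne_zero φ (by simp [hw, ha, h]),
    map_inv_of_constantCoeff_ne_zero φ (by simp [hw, hb, h])]
  simp

lemma map_wpTerm (hw : MvPowerSeries.constantCoeff w = 0) (ha : MvPowerSeries.constantCoeff a = 0)
    (hb : MvPowerSeries.constantCoeff b = 0) (s : ℕ) {q : ℕ} (hq : 1 ≤ q) :
    φ (wpTerm w a b s q) = wpTerm (φ w) (φ a) (φ b) s q := by
  have h : ((q : ℝ) + s) ≠ 0 := by positivity
  have h' : (q : ℝ) ≠ 0 := by positivity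
  simp only [wpTerm, map_mul]
  rw [map_inv_of_constantCoeff_ne_zero φ (by simpa using h'),
    map_inv_of_constantCoeff_ne_zero φ (by simp [hw, h]),
    map_inv_of_constantCoeff_ne_zero φ (by simp [hw, ha, h]),
    map_inv_of_constantCoeff_ne_zero φ (by simp [hw, hb, h]), map_wpProd φ hw ha hb]
  simp [map_ofNat φ 2]

lemma map_wpCert (hw : MvPowerSeries.constantCoeff w = 0) (ha : MvPowerSeries.constantCoeff a = 0)
    (hb : MvPowerSeries.constantCoeff b = 0) (s : ℕ) {q : ℕ} (hq : 1 ≤ q) :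
    φ (wpCert w a b s q) = wpCert (φ w) (φ a) (φ b) s q := by
  have h : ((q : ℝ) + s) ≠ 0 := by positivity
  have h' : (s : ℝ) + 1 ≠ 0 := by positivity
  simp only [wpCert, map_mul]
  rw [map_inv_of_constantCoeff_ne_zero φ (by simp [ha, hb, h']),
    map_inv_of_constantCoeff_ne_zero φ (by simp [hw, h]),
    map_inv_of_constantCoeff_ne_zero φ (by simp [hw, ha, h]),
    map_inv_of_constantCoeff_ne_zero φ (by simp [hw, hb, h]), map_wpProd φ hw ha hb]
  simp [map_ofNat φ 2]

end Map

lemma algebraMap_fractionRing_ne_zero {f : Series} (hf : MvPowerSeries.constantCoeff f ≠ 0) :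
    algebraMap Series (FractionRing Series) f ≠ 0 := by
  rw [Ne, FaithfulSMul.algebraMap_eq_zero_iff]
  rintro rfl
  exact hf (map_zero _)

section Series

variable {w a b : Series}

/-- `sum_wpTerm` holds for power series, which embed into their fraction field. -/
lemma sum_wpTerm_series (hw : MvPowerSeries.constantCoeff w = 0)
    (ha : MvPowerSeries.constantCoeff a = 0) (hb : MvPowerSeries.constantCoeff b = 0) (M N : ℕ) :
    ∑ q ∈ Finset.Ico 1 (N + 1), wpTerm w a b 0 q =
      ∑ s ∈ Finset.range M, wpCert w a b s 1 + ∑ q ∈ Finset.Ico 1 (N + 1), wpTerm w a b M q -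
        ∑ s ∈ Finset.range M, wpCert w a b s (N + 1) := by
  apply FaithfulSMul.algebraMap_injective Series (FractionRing Series)
  set φ := algebraMap Series (FractionRing Series) with hφ
  have key : ∀ f : Series, MvPowerSeries.constantCoeff f = 0 → ∀ n : ℕ, 1 ≤ n →
      (n : FractionRing Series) - φ f ≠ 0 := by
    intro f hf n hn
    have h : (n : ℝ) ≠ 0 := by positivity
    simpa using algebraMap_fractionRing_ne_zero (f := (n : Series) - f) (by simpa [hf] using h)
  have h := sum_wpTerm (w := φ w) (a := φ a) (b := φ b)
    (fun n hn => by simpa using key 0 (map_zero _) n hn)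
    (fun n hn => by simpa [map_ofNat φ 2] using key (2 * w) (by simp [hw]) n hn)
    (fun n hn => by simpa [sub_sub] using key (w + a) (by simp [hw, ha]) n hn)
    (fun n hn => by simpa [sub_sub] using key (w + b) (by simp [hw, hb]) n hn)
    (fun n hn => by simpa [sub_sub] using key (a + b) (by simp [ha, hb]) n hn) M N
  simp only [map_sub, map_add, map_sum]
  rw [Finset.sum_congr rfl fun q hq => map_wpTerm φ hw ha hb 0 (Finset.mem_Ico.1 hq).1,
    Finset.sum_congr rfl fun q hq => map_wpTerm φ hw ha hb M (Finset.mem_Ico.1 hq).1,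
    Finset.sum_congr rfl fun s _ => map_wpCert φ hw ha hb s le_rfl,
    Finset.sum_congr rfl fun s _ => map_wpCert φ hw ha hb s (by omega : 1 ≤ N + 1)]
  exact h

lemma mul_wpCert_one_series (hw : MvPowerSeries.constantCoeff w = 0)
    (ha : MvPowerSeries.constantCoeff a = 0) (hb : MvPowerSeries.constantCoeff b = 0) (s : ℕ) :
    (w - a) * (w - b) * wpCert w a b s 1 =
      ((s : Series) + 1 - 2 * w)⁻¹ + ((s : Series) + 1 - a - b)⁻¹ - ((s : Series) + 1 - w - a)⁻¹ -
        ((s : Series) + 1 - w - b)⁻¹ := by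
  apply FaithfulSMul.algebraMap_injective Series (FractionRing Series)
  set φ := algebraMap Series (FractionRing Series) with hφ
  have key : ∀ f : Series, MvPowerSeries.constantCoeff f = 0 → ∀ n : ℕ, 1 ≤ n →
      (n : FractionRing Series) - φ f ≠ 0 := by
    intro f hf n hn
    have h : (n : ℝ) ≠ 0 := by positivity
    simpa using algebraMap_fractionRing_ne_zero (f := (n : Series) - f) (by simpa [hf] using h)
  have h := mul_wpCert_one (w := φ w) (a := φ a) (b := φ b)
    (fun n hn => by simpa [map_ofNat φ 2] using key (2 * w) (by simp [hw]) n hn)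
    (fun n hn => by simpa [sub_sub] using key (w + a) (by simp [hw, ha]) n hn)
    (fun n hn => by simpa [sub_sub] using key (w + b) (by simp [hw, hb]) n hn)
    (fun n hn => by simpa [sub_sub] using key (a + b) (by simp [ha, hb]) n hn) s
  have h' : (s : ℝ) + 1 ≠ 0 := by positivity
  simp only [map_sub, map_add, map_mul]
  rw [map_wpCert φ hw ha hb s le_rfl,
    map_inv_of_constantCoeff_ne_zero φ (by simp [hw, h']),
    map_inv_of_constantCoeff_ne_zero φ (by simp [ha, hb, h']),
    map_inv_of_constantCoeff_ne_zero φ (by simp [hw, ha, h']),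
    map_inv_of_constantCoeff_ne_zero φ (by simp [hw, hb, h'])]
  simpa [map_ofNat φ 2] using h

/-! ### Estimates for the remainder -/

variable {D : Fin 3 →₀ ℕ}

lemma truncNorm_inv_sub_le {f g : Series} {c : ℝ} (hf : f = MvPowerSeries.C c - g)
    (hg : truncNorm D g ≤ 1 / 20) (hc : 1 ≤ c) : truncNorm D f⁻¹ ≤ 1 / (c - 1 / 20) := by
  refine truncNorm_inv_le ?_ (by linarith)
  rwa [hf, sub_sub_cancel_left, truncNorm_neg]

lemma truncNorm_C_add_le {f g : Series} {c x : ℝ} (hf : f = MvPowerSeries.C c + g) (hc : 0 ≤ c)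
    (hg : truncNorm D g ≤ x) : truncNorm D f ≤ c + x := by
  rw [hf]
  exact truncNorm_add_le.trans (add_le_add ((truncNorm_C_le c).trans_eq (abs_of_nonneg hc)) hg)

lemma truncNorm_two_mul_le {f : Series} {x : ℝ} (hf : truncNorm D f ≤ x) :
    truncNorm D (2 * f) ≤ 2 * x := by
  rw [two_mul, two_mul]
  exact truncNorm_add_le.trans (add_le_add hf hf)

lemma sqrt_mul_ratio_le {q : ℝ} (hq : 1 ≤ q) :
    √q * ((q + 1 / 20) * (q + 1 / 20) * (1 / (q - 1 / 20)) * (1 / (q - 1 / 20))) ≤ √(q + 1) := by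
  have h1 : (q + 1 / 20) * (q + 1 / 20) * (1 / (q - 1 / 20)) * (1 / (q - 1 / 20)) =
      ((q + 1 / 20) / (q - 1 / 20)) ^ 2 := by
    field_simp
  have h2 : (q + 1 / 20) / (q - 1 / 20) ≤ 1 + 1 / (8 * q) := by
    rw [div_le_iff₀ (by linarith)]
    have : (1 + 1 / (8 * q)) * (q - 1 / 20) = q - 1 / 20 + 1 / 8 - 1 / (160 * q) := by
      field_simp
      ring
    rw [this]
    have : 1 / (160 * q) ≤ 1 / 160 := by
      apply one_div_le_one_div_of_le <;> linarith
    linarith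
  have h0 : 0 ≤ (q + 1 / 20) / (q - 1 / 20) := div_nonneg (by linarith) (by linarith)
  have h3 : (1 + 1 / (8 * q)) ^ 2 ≤ 1 + 1 / (3 * q) := by
    have hx : 0 ≤ 1 / q := by positivity
    have hx1 : 1 / q ≤ 1 := by rw [div_le_one (by linarith)]; exact hq
    have h8 : 1 / (8 * q) = 1 / q / 8 := by field_simp
    have h3 : 1 / (3 * q) = 1 / q / 3 := by field_simp
    rw [h8, h3]
    nlinarith
  have h4 : √q * (1 + 1 / (3 * q)) ≤ √(q + 1) := by
    apply Real.le_sqrt_of_sq_le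
    rw [mul_pow, Real.sq_sqrt (by linarith)]
    have : q * (1 + 1 / (3 * q)) ^ 2 = q + 2 / 3 + 1 / (9 * q) := by
      field_simp
      ring
    rw [this]
    have : 1 / (9 * q) ≤ 1 / 9 := by
      apply one_div_le_one_div_of_le <;> linarith
    linarith
  rw [h1]
  refine le_trans ?_ h4
  gcongr
  exact (pow_le_pow_left₀ h0 h2 2).trans h3

/-- Any growth slower than `q` makes the sum of the `N` remainders `wpCert w a b s (N + 1)` tend to
zero; the weight `1 / 40` of `W` in `truncNorm` is small enough to reach `√q`. -/
lemma truncNorm_wpProd_le (hw : truncNorm D w ≤ 1 / 40) (ha : truncNorm D a ≤ 1 / 80)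
    (hb : truncNorm D b ≤ 1 / 80) (s : ℕ) {q : ℕ} (hq : 1 ≤ q) :
    truncNorm D (wpProd w a b s q) ≤ √q := by
  induction q, hq using Nat.le_induction with
  | base => simpa [wpProd] using truncNorm_one_le (D := D)
  | succ q hq ih =>
    have hq1 : (1 : ℝ) ≤ q := by exact_mod_cast hq
    have hs : (0 : ℝ) ≤ s := s.cast_nonneg
    have num : ∀ x : Series, truncNorm D x ≤ 1 / 80 →
        truncNorm D ((q : Series) - w + x) ≤ (q : ℝ) + 1 / 20 := fun x hx =>
      truncNorm_C_add_le (g := x - w) (by rw [map_natCast]; ring) (by positivity)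
        (truncNorm_sub_le.trans (by linarith))
    have den : ∀ x : Series, truncNorm D x ≤ 1 / 80 →
        truncNorm D ((q : Series) + s - w - x)⁻¹ ≤ 1 / ((q : ℝ) - 1 / 20) := fun x hx => by
      refine (truncNorm_inv_sub_le (g := w + x) (c := q + s) ?_
        (truncNorm_add_le.trans (by linarith)) (by linarith)).trans ?_
      · rw [map_add, map_natCast, map_natCast]; ring
      · apply one_div_le_one_div_of_le <;> linarith
    rw [wpProd_succ _ _ _ _ hq]
    push_cast
    refine le_trans ?_ (sqrt_mul_ratio_le hq1)
    exact truncNorm_mul_le_of_le ih (truncNorm_mul_le_of_le (truncNorm_mul_le_of_le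
      (truncNorm_mul_le_of_le (num a ha) (num b hb)) (den a ha)) (den b hb))

lemma truncNorm_wpTerm_le (hw : truncNorm D w ≤ 1 / 40) (ha : truncNorm D a ≤ 1 / 80)
    (hb : truncNorm D b ≤ 1 / 80) (s : ℕ) {q : ℕ} (hq : 1 ≤ q) :
    truncNorm D (wpTerm w a b s q) ≤ 12 / ((q : ℝ) + s) ^ 2 := by
  have hq1 : (1 : ℝ) ≤ q := by exact_mod_cast hq
  have hs : (0 : ℝ) ≤ s := s.cast_nonneg
  have hC : (MvPowerSeries.C ((q : ℝ) + s) : Series) = (q : Series) + s := by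
    rw [map_add, map_natCast, map_natCast]
  have h1 : truncNorm D (2 * (q : Series) + s - 2 * w) ≤ (2 * q + s) + 1 / 20 :=
    truncNorm_C_add_le (g := -(2 * w)) (c := 2 * q + s)
      (by rw [two_mul (q : ℝ)]; simp only [map_add, map_natCast]; ring) (by positivity)
      (by rw [truncNorm_neg]; exact (truncNorm_two_mul_le hw).trans (by norm_num))
  have h2 : truncNorm D (q : Series)⁻¹ ≤ 1 / q := by
    have : (q : Series)⁻¹ = MvPowerSeries.C (q : ℝ)⁻¹ := by
      rw [← MvPowerSeries.C_inv, map_natCast]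
    rw [this, one_div]
    exact (truncNorm_C_le _).trans_eq (abs_of_pos (by positivity))
  have h3 : truncNorm D ((q : Series) + s - 2 * w)⁻¹ ≤ 1 / (q + s - 1 / 20) :=
    truncNorm_inv_sub_le (by rw [hC]) ((truncNorm_two_mul_le hw).trans (by norm_num))
      (by linarith)
  have h4 : ∀ x : Series, truncNorm D x ≤ 1 / 80 →
      truncNorm D ((q : Series) + s - w - x)⁻¹ ≤ 1 / (q + s - 1 / 20) := fun x hx =>
    truncNorm_inv_sub_le (g := w + x) (by rw [hC, sub_sub])
      (truncNorm_add_le.trans (by linarith)) (by linarith)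
  refine (truncNorm_mul_le_of_le (truncNorm_mul_le_of_le (truncNorm_mul_le_of_le
    (truncNorm_mul_le_of_le (truncNorm_mul_le_of_le h1 h2) h3) (h4 a ha)) (h4 b hb))
    (truncNorm_wpProd_le hw ha hb s hq)).trans ?_
  have hy : 0 < (q : ℝ) + s - 1 / 20 := by linarith
  have h5 : √(q : ℝ) / q ≤ 1 := by
    rw [div_le_one (by linarith)]
    exact Real.sqrt_le_iff.2 ⟨by linarith, by nlinarith⟩
  calc _ = (2 * q + s + 1 / 20) / (q + s - 1 / 20) * (1 / (q + s - 1 / 20) ^ 2) *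
        (√(q : ℝ) / q) := by field_simp
    _ ≤ 3 * (1 / (((q : ℝ) + s) / 2) ^ 2) * 1 := by
        gcongr
        · rw [div_le_iff₀ hy]; linarith
        · linarith
    _ = 12 / ((q : ℝ) + s) ^ 2 := by field_simp; norm_num

lemma truncNorm_wpCert_le (hw : truncNorm D w ≤ 1 / 40) (ha : truncNorm D a ≤ 1 / 80)
    (hb : truncNorm D b ≤ 1 / 80) (s : ℕ) {q : ℕ} (hq : 1 ≤ q) :
    truncNorm D (wpCert w a b s q) ≤ 24 * √q / (q : ℝ) ^ 2 := by
  have hq1 : (1 : ℝ) ≤ q := by exact_mod_cast hq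
  have hs : (0 : ℝ) ≤ s := s.cast_nonneg
  have hC : (MvPowerSeries.C ((q : ℝ) + s) : Series) = (q : Series) + s := by
    rw [map_add, map_natCast, map_natCast]
  have h1 : truncNorm D ((q : Series) + 1 + 2 * s - 2 * w - a - b) ≤
      ((q : ℝ) + 1 + (s + s)) + 1 / 10 :=
    truncNorm_C_add_le (g := -(2 * w + (a + b)))
      (by simp only [map_add, map_natCast, map_one]; ring) (by positivity)
      (by
        rw [truncNorm_neg]
        refine truncNorm_add_le.trans ((add_le_add (truncNorm_two_mul_le hw)
          (truncNorm_add_le.trans (add_le_add ha hb))).trans (by norm_num)))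
  have h2 : truncNorm D ((s : Series) + 1 - a - b)⁻¹ ≤ 2 := by
    refine (truncNorm_inv_sub_le (g := a + b) (c := s + 1)
      (by simp only [map_add, map_natCast, map_one]; ring)
      (truncNorm_add_le.trans (by linarith)) (by linarith)).trans ?_
    rw [div_le_iff₀ (by linarith)]
    linarith
  have h3 : truncNorm D ((q : Series) + s - 2 * w)⁻¹ ≤ 1 / (q + s - 1 / 20) :=
    truncNorm_inv_sub_le (by rw [hC]) ((truncNorm_two_mul_le hw).trans (by norm_num))
      (by linarith)
  have h4 : ∀ x : Series, truncNorm D x ≤ 1 / 80 →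
      truncNorm D ((q : Series) + s - w - x)⁻¹ ≤ 1 / (q + s - 1 / 20) := fun x hx =>
    truncNorm_inv_sub_le (g := w + x) (by rw [hC, sub_sub])
      (truncNorm_add_le.trans (by linarith)) (by linarith)
  refine (truncNorm_mul_le_of_le (truncNorm_mul_le_of_le (truncNorm_mul_le_of_le
    (truncNorm_mul_le_of_le (truncNorm_mul_le_of_le h1 h2) h3) (h4 a ha)) (h4 b hb))
    (truncNorm_wpProd_le hw ha hb s hq)).trans ?_
  have hy : 0 < (q : ℝ) + s - 1 / 20 := by linarith
  calc _ = (q + 1 + (s + s) + 1 / 10) / (q + s - 1 / 20) * 2 * (1 / (q + s - 1 / 20) ^ 2) *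
        √(q : ℝ) := by field_simp
    _ ≤ 3 * 2 * (1 / ((q : ℝ) / 2) ^ 2) * √(q : ℝ) := by
        gcongr
        · rw [div_le_iff₀ hy]; linarith
        · linarith
    _ = 24 * √q / (q : ℝ) ^ 2 := by field_simp; norm_num

/-- Raising the shift `N` times turns the truncated well-poised sum into a sum of boundary terms.
The two remainders are at most `12 / N` and `24 / √N`. -/
lemma tendsto_sum_wpTerm_sub (hw0 : MvPowerSeries.constantCoeff w = 0)
    (ha0 : MvPowerSeries.constantCoeff a = 0) (hb0 : MvPowerSeries.constantCoeff b = 0)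
    (hw : ∀ D, truncNorm D w ≤ 1 / 40) (ha : ∀ D, truncNorm D a ≤ 1 / 80)
    (hb : ∀ D, truncNorm D b ≤ 1 / 80) :
    Tendsto (fun N : ℕ => ∑ q ∈ Finset.Ico 1 (N + 1), wpTerm w a b 0 q -
      ∑ s ∈ Finset.range N, wpCert w a b s 1) atTop (𝓝 0) := by
  rw [MvPowerSeries.WithPiTopology.tendsto_iff_coeff_tendsto]
  intro D
  rw [map_zero]
  have hlim : Tendsto (fun N : ℕ => 40 ^ D 2 * (12 * (1 / (N : ℝ)) + 24 * (1 / √(N : ℝ)))) atTop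
      (𝓝 0) := by
    have h1 : Tendsto (fun N : ℕ => 1 / (N : ℝ)) atTop (𝓝 0) := tendsto_one_div_atTop_nhds_zero_nat
    have h2 : Tendsto (fun N : ℕ => 1 / √(N : ℝ)) atTop (𝓝 0) := by
      simp only [one_div]
      exact (Real.tendsto_sqrt_atTop.comp tendsto_natCast_atTop_atTop).inv_tendsto_atTop
    simpa using ((h1.const_mul 12).add (h2.const_mul 24)).const_mul (40 ^ D 2)
  refine squeeze_zero_norm' ?_ hlim
  filter_upwards [eventually_ge_atTop 1] with N hN
  have hN0 : (0 : ℝ) < N := by exact_mod_cast hN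
  -- The number of shifts equals the truncation, so that a single limit is needed.
  rw [sum_wpTerm_series hw0 ha0 hb0 N N, Real.norm_eq_abs, add_sub_assoc, add_sub_cancel_left]
  refine abs_coeff_le_truncNorm.trans ?_
  gcongr
  refine truncNorm_sub_le.trans (add_le_add ?_ ?_)
  · calc _ ≤ ∑ q ∈ Finset.Ico 1 (N + 1), 12 / (N : ℝ) ^ 2 := by
          refine (truncNorm_sum_le _ _).trans (Finset.sum_le_sum fun q hq => ?_)
          refine (truncNorm_wpTerm_le (hw D) (ha D) (hb D) N (Finset.mem_Ico.1 hq).1).trans ?_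
          gcongr
          simp
      _ = 12 * (1 / (N : ℝ)) := by
          rw [Finset.sum_const, Nat.card_Ico, nsmul_eq_mul, Nat.add_sub_cancel]
          field_simp
  · calc _ ≤ ∑ s ∈ Finset.range N, 24 * √((N + 1 : ℕ) : ℝ) / ((N + 1 : ℕ) : ℝ) ^ 2 := by
          refine (truncNorm_sum_le _ _).trans (Finset.sum_le_sum fun s _ => ?_)
          exact truncNorm_wpCert_le (hw D) (ha D) (hb D) s (by omega)
      _ ≤ ∑ s ∈ Finset.range N, 24 * (1 / (N * √(N : ℝ))) := by
          refine Finset.sum_le_sum fun s _ => ?_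
          have hM : (0 : ℝ) < ((N + 1 : ℕ) : ℝ) := by positivity
          have h : 24 * √((N + 1 : ℕ) : ℝ) / ((N + 1 : ℕ) : ℝ) ^ 2 =
              24 * (1 / (((N + 1 : ℕ) : ℝ) * √((N + 1 : ℕ) : ℝ))) := by
            have h0 : √((N + 1 : ℕ) : ℝ) ≠ 0 := (Real.sqrt_pos.2 hM).ne'
            have h1 := Real.mul_self_sqrt hM.le
            rw [div_eq_iff (by positivity)]
            field_simp
            rw [pow_two, h1]
          rw [h]
          have hs0 : 0 < √(N : ℝ) := Real.sqrt_pos.2 hN0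
          gcongr <;> simp
      _ = 24 * (1 / √(N : ℝ)) := by
          rw [Finset.sum_const, Finset.card_range, nsmul_eq_mul]
          field_simp

end Series
end Transformation

/-! ### Geometric series and `ψ₁` -/

section Psi

open Filter Topology
open scoped MvPowerSeries.WithPiTopology

lemma hasSum_inv_C_sub {c : ℝ} (hc : c ≠ 0) {f : Series}
    (hf : MvPowerSeries.constantCoeff f = 0) :
    HasSum (fun k : ℕ => MvPowerSeries.C (c⁻¹ ^ (k + 1)) * f ^ k) (MvPowerSeries.C c - f)⁻¹ := by
  have hg : MvPowerSeries.constantCoeff (MvPowerSeries.C c⁻¹ * f) = 0 := by simp [hf]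
  have h1 := (MvPowerSeries.WithPiTopology.summable_pow_of_constantCoeff_eq_zero hg).hasSum.mul_left
    (MvPowerSeries.C c⁻¹)
  have h2 := MvPowerSeries.WithPiTopology.one_sub_mul_tsum_pow_of_constantCoeff_eq_zero hg
  have hC : (MvPowerSeries.C c⁻¹ : Series) * MvPowerSeries.C c = 1 := by
    rw [← map_mul, inv_mul_cancel₀ hc, map_one]
  have h3 : (MvPowerSeries.C c - f)⁻¹ =
      MvPowerSeries.C c⁻¹ * ∑' k : ℕ, (MvPowerSeries.C c⁻¹ * f) ^ k := by
    rw [MvPowerSeries.inv_eq_iff_mul_eq_one (by simpa [hf] using hc)]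
    linear_combination h2 + (∑' k : ℕ, (MvPowerSeries.C c⁻¹ * f) ^ k) * hC
  have h4 : (fun k : ℕ => MvPowerSeries.C (c⁻¹ ^ (k + 1)) * f ^ k) =
      fun k => MvPowerSeries.C c⁻¹ * (MvPowerSeries.C c⁻¹ * f) ^ k := by
    funext k
    rw [mul_pow, pow_succ, map_mul, map_pow]
    ring
  rw [h3, h4]
  exact h1

lemma coeff_inv_C_sub {c : ℝ} (hc : c ≠ 0) {f : Series}
    (hf : MvPowerSeries.constantCoeff f = 0) (d : Fin 3 →₀ ℕ) :
    MvPowerSeries.coeff d (MvPowerSeries.C c - f)⁻¹ =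
      ∑ k ∈ Finset.range (d.degree + 1), c⁻¹ ^ (k + 1) * MvPowerSeries.coeff d (f ^ k) := by
  have h := MvPowerSeries.WithPiTopology.hasSum_iff_hasSum_coeff.1 (hasSum_inv_C_sub hc hf) d
  simp only [MvPowerSeries.coeff_C_mul] at h
  refine h.unique (hasSum_sum_of_ne_finset_zero fun k hk => ?_)
  rw [MvPowerSeries.coeff_eq_zero_of_constantCoeff_nilpotent (m := 1) (by rw [hf, pow_one])
    (by rw [Finset.mem_range] at hk; omega), mul_zero]

lemma coeff_psiOneAt {f : Series} (hf : MvPowerSeries.constantCoeff f = 0) (d : Fin 3 →₀ ℕ) :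
    MvPowerSeries.coeff d (psiOneAt f) =
      ∑ k ∈ Finset.range (d.degree + 1),
        (if k = 0 then 0 else (riemannZeta ((k + 1 : ℕ) : ℂ)).re) *
          MvPowerSeries.coeff d (f ^ k) := by
  rw [psiOneAt, PowerSeries.coeff_subst (PowerSeries.HasSubst.of_constantCoeff_zero hf),
    finsum_eq_sum_of_support_subset (s := Finset.range (d.degree + 1))]
  · simp only [psiOne, PowerSeries.coeff_mk, smul_eq_mul]
  · intro k hk
    rw [Function.mem_support] at hk
    by_contra hk'
    refine hk ?_
    rw [MvPowerSeries.coeff_eq_zero_of_constantCoeff_nilpotent (m := 1) (by rw [hf, pow_one])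
      (by rw [Finset.coe_range, Set.mem_Iio] at hk'; omega), smul_zero]

lemma tendsto_sum_inv_pow {k : ℕ} (hk : k ≠ 0) :
    Tendsto (fun N : ℕ => ∑ s ∈ Finset.range N, ((s : ℝ) + 1)⁻¹ ^ (k + 1)) atTop
      (𝓝 (riemannZeta ((k + 1 : ℕ) : ℂ)).re) := by
  have hsum : Summable fun n : ℕ => 1 / (n : ℝ) ^ (k + 1) :=
    Real.summable_one_div_nat_pow.2 (by omega)
  have hz : (riemannZeta ((k + 1 : ℕ) : ℂ)).re = ∑' n : ℕ, 1 / (n : ℝ) ^ (k + 1) := by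
    rw [zeta_nat_eq_tsum_of_gt_one (by omega), ← Complex.ofReal_re (∑' n : ℕ, _),
      Complex.ofReal_tsum]
    push_cast
    rfl
  rw [hz]
  have h := (hasSum_nat_add_iff' 1).2 hsum.hasSum
  simp only [Finset.range_one, Finset.sum_singleton, Nat.cast_zero, ne_eq, Nat.add_eq_zero_iff,
    one_ne_zero, and_false, not_false_eq_true, zero_pow, div_zero, sub_zero] at h
  refine h.tendsto_sum_nat.congr fun N => Finset.sum_congr rfl fun s _ => ?_
  rw [one_div, inv_pow]
  push_cast
  rfl

/-- The expansion `ψ₁(X) = ∑_{n ≥ 1} (1 / (n - X) - 1 / n)`. -/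
lemma tendsto_sum_inv_sub {f : Series} (hf : MvPowerSeries.constantCoeff f = 0) :
    Tendsto (fun N : ℕ => ∑ s ∈ Finset.range N,
      (((s : Series) + 1 - f)⁻¹ - ((s : Series) + 1)⁻¹)) atTop (𝓝 (psiOneAt f)) := by
  rw [MvPowerSeries.WithPiTopology.tendsto_iff_coeff_tendsto]
  intro d
  rw [coeff_psiOneAt hf]
  have hterm : ∀ s : ℕ, MvPowerSeries.coeff d (((s : Series) + 1 - f)⁻¹ - ((s : Series) + 1)⁻¹) =
      ∑ k ∈ Finset.range (d.degree + 1),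
        (if k = 0 then 0 else ((s : ℝ) + 1)⁻¹ ^ (k + 1)) * MvPowerSeries.coeff d (f ^ k) := by
    intro s
    have hs : ((s : ℝ) + 1) ≠ 0 := by positivity
    have hC : ((s : Series) + 1) = MvPowerSeries.C ((s : ℝ) + 1) := by simp
    rw [map_sub, hC, coeff_inv_C_sub hs hf, MvPowerSeries.C_inv, Finset.sum_range_succ',
      Finset.sum_range_succ']
    have h0 : MvPowerSeries.coeff d (MvPowerSeries.C ((s : ℝ) + 1)⁻¹ : Series) =
        ((s : ℝ) + 1)⁻¹ * MvPowerSeries.coeff d (1 : Series) := by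
      rw [← MvPowerSeries.coeff_C_mul, mul_one]
    simp [h0]
  simp only [map_sum, hterm]
  simp only [Finset.sum_comm (s := Finset.range _) (t := Finset.range (d.degree + 1)),
    ← Finset.sum_mul]
  refine tendsto_finsetSum _ fun k _ => Tendsto.mul_const _ ?_
  split_ifs with hk
  · simp
  · exact tendsto_sum_inv_pow hk

end Psi

/-! ### Convergence of the truncated anti-hook sums -/

section Convergence

open Filter Topology

/-- The sum of the contributions of one arm `k` below a fixed corner `q`. -/
def armSum (t : ℝ) (k : Index) (q : ℕ) : ℝ := ∑ m ∈ chains k.length q, armWeight t k m q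

lemma zetaTrunc_eq (t : ℝ) (k l : Index) (a N : ℕ) :
    zetaTrunc t k l a N =
      ∑ q ∈ Finset.Icc 1 N, armSum t k q * (1 / (q : ℝ) ^ a) * armSum (1 - t) l q := by
  refine Finset.sum_congr rfl fun q _ => ?_
  simp only [armSum, Finset.sum_mul, Finset.mul_sum]
  rw [Finset.sum_comm]

lemma armSum_nonneg {t : ℝ} (ht : 0 ≤ t) (k : Index) (q : ℕ) : 0 ≤ armSum t k q :=
  Finset.sum_nonneg fun _ _ => div_nonneg (pow_nonneg ht _) (Finset.prod_nonneg fun _ _ => by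
    positivity)

lemma armSum_le {t : ℝ} (ht : 0 ≤ t) (ht1 : t ≤ 1) (k : Index) (q : ℕ) :
    armSum t k q ≤ (1 + Real.log q) ^ k.length := by
  calc armSum t k q ≤ ∑ m ∈ chains k.length q, ∏ i, ((m i : ℝ))⁻¹ := by
        refine Finset.sum_le_sum fun m hm => ?_
        have hm1 : ∀ i, 1 ≤ m i := fun i =>
          (Finset.mem_Icc.1 (Fintype.mem_piFinset.1 (Finset.mem_filter.1 hm).1 i)).1
        rw [armWeight, Finset.prod_inv_distrib, ← one_div]
        have hpos : 0 < ∏ i, (m i : ℝ) := Finset.prod_pos fun i _ => by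
          have := hm1 i
          positivity
        gcongr with i
        · exact pow_le_one₀ ht ht1
        · exact le_self_pow₀ (by exact_mod_cast hm1 i) (k.get i).ne_zero
    _ ≤ ∑ m ∈ Fintype.piFinset fun _ : Fin k.length => Finset.Icc 1 q, ∏ i, ((m i : ℝ))⁻¹ :=
        Finset.sum_le_sum_of_subset_of_nonneg (Finset.filter_subset _ _) fun m _ _ =>
          Finset.prod_nonneg fun _ _ => by positivity
    _ = (∑ m ∈ Finset.Icc 1 q, (m : ℝ)⁻¹) ^ k.length := by
        rw [← Finset.prod_univ_sum (fun _ : Fin k.length => Finset.Icc 1 q) fun _ m => (m : ℝ)⁻¹,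
          Finset.prod_const, Finset.card_univ, Fintype.card_fin]
    _ ≤ _ := by
        gcongr
        have := harmonic_le_one_add_log q
        rw [harmonic_eq_sum_Icc] at this
        push_cast at this
        exact this

lemma summable_one_add_log_pow (n : ℕ) :
    Summable fun q : ℕ => (1 + Real.log q) ^ n * (1 / (q : ℝ) ^ 2) := by
  set ε : ℝ := 1 / (2 * (n + 1)) with hε
  have hε0 : 0 < ε := by positivity
  have hs : Summable fun q : ℕ => (1 + 1 / ε) ^ n * (q : ℝ) ^ (-(3 / 2) : ℝ) :=
    (Real.summable_nat_rpow.2 (by norm_num)).mul_left _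
  refine Summable.of_nonneg_of_le (fun q => ?_) (fun q => ?_) hs
  · have := Real.log_natCast_nonneg q
    positivity
  · rcases Nat.eq_zero_or_pos q with rfl | hq
    · simp
    have hq1 : (1 : ℝ) ≤ q := by exact_mod_cast hq
    have hlog := Real.log_natCast_nonneg q
    have h1 : 1 + Real.log q ≤ (1 + 1 / ε) * (q : ℝ) ^ ε := by
      have h2 := Real.log_le_rpow_div (x := q) (by positivity) hε0
      have h3 := Real.one_le_rpow hq1 hε0.le
      rw [add_mul, one_mul, one_div_mul_eq_div]
      linarith
    have h4 : ((q : ℝ) ^ ε) ^ n ≤ (q : ℝ) ^ (1 / 2 : ℝ) := by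
      rw [← Real.rpow_natCast, ← Real.rpow_mul (by positivity)]
      refine Real.rpow_le_rpow_of_exponent_le hq1 ?_
      rw [hε, one_div_mul_eq_div, div_le_div_iff₀ (by positivity) (by positivity)]
      linarith
    calc (1 + Real.log q) ^ n * (1 / (q : ℝ) ^ 2)
        ≤ ((1 + 1 / ε) * (q : ℝ) ^ ε) ^ n * (1 / (q : ℝ) ^ 2) := by gcongr
      _ ≤ (1 + 1 / ε) ^ n * (q : ℝ) ^ (1 / 2 : ℝ) * (1 / (q : ℝ) ^ 2) := by
          rw [mul_pow]
          gcongr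
      _ = _ := by
          rw [mul_assoc, one_div ((q : ℝ) ^ 2), ← Real.rpow_natCast (q : ℝ),
            ← Real.rpow_neg (by positivity), ← Real.rpow_add (by positivity)]
          norm_num

lemma tendsto_zetaTrunc {t : ℝ} (ht : 0 ≤ t) (ht1 : t ≤ 1) (k l : Index) {a : ℕ} (ha : 2 ≤ a) :
    Tendsto (zetaTrunc t k l a) atTop (𝓝 (zeta t k l a)) := by
  refine tendsto_nhds_limUnder ?_
  set F : ℕ → ℝ := fun q => armSum t k q * (1 / (q : ℝ) ^ a) * armSum (1 - t) l q with hF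
  have hsum : Summable F := by
    refine Summable.of_nonneg_of_le (fun q => ?_) (fun q => ?_)
      (summable_one_add_log_pow (k.length + l.length))
    · exact mul_nonneg (mul_nonneg (armSum_nonneg ht k q) (by positivity))
        (armSum_nonneg (by linarith) l q)
    · have hlog := Real.log_natCast_nonneg q
      have h1 : 1 / (q : ℝ) ^ a ≤ 1 / (q : ℝ) ^ 2 := by
        rcases Nat.eq_zero_or_pos q with rfl | hq
        · simp [show a ≠ 0 by omega]
        · have hq1 : (1 : ℝ) ≤ q := by exact_mod_cast hq
          gcongr
      calc F q ≤ (1 + Real.log q) ^ k.length * (1 / (q : ℝ) ^ 2) *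
            (1 + Real.log q) ^ l.length := by
            have h2 := armSum_le ht ht1 k q
            have h3 := armSum_le (sub_nonneg.2 ht1) (by linarith) l q
            have h4 := armSum_nonneg (sub_nonneg.2 ht1) l q
            simp only [hF]
            gcongr
        _ = _ := by ring
  have h0 : F 0 = 0 := by simp [hF, show a ≠ 0 by omega]
  refine ⟨_, ((hsum.hasSum.tendsto_sum_nat).comp (tendsto_add_atTop_nat 1)).congr fun N => ?_⟩
  rw [zetaTrunc_eq, Function.comp_apply, Finset.range_eq_Ico,
    Finset.sum_eq_sum_Ico_succ_bot (by omega), h0, zero_add]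
  rfl

end Convergence

/-! ### Recursion for the sum over one arm -/

section Arm

/-- The sum over weakly increasing sequences underlying `armSum`, for an arbitrary exponent
vector `e`. Indexing by `Fin r` makes the removal of the last entry accessible. -/
def chainSum (t : ℝ) (r : ℕ) (e : Fin r → ℕ) (q : ℕ) : ℝ :=
  ∑ m ∈ chains r q, t ^ (r + 1 - numDistinct m q) / ∏ i, (m i : ℝ) ^ e i

lemma armSum_eq_chainSum (t : ℝ) (k : Index) (q : ℕ) :
    armSum t k q = chainSum t k.length (fun i => (k.get i : ℕ)) q := rfl

lemma chainSum_cast (t : ℝ) {r r' : ℕ} (h : r = r') {e : Fin r → ℕ} {e' : Fin r' → ℕ}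
    (he : ∀ i, e i = e' (Fin.cast h i)) (q : ℕ) : chainSum t r e q = chainSum t r' e' q := by
  subst h
  obtain rfl : e = e' := funext he
  rfl

lemma mem_chains {r q : ℕ} {m : Fin r → ℕ} :
    m ∈ chains r q ↔ (∀ i, 1 ≤ m i ∧ m i ≤ q) ∧ Monotone m := by
  simp [chains]

lemma mem_chains_succ {r q : ℕ} {m : Fin (r + 1) → ℕ} :
    m ∈ chains (r + 1) q ↔
      m (Fin.last r) ∈ Finset.Icc 1 q ∧ Fin.init m ∈ chains r (m (Fin.last r)) := by
  rw [mem_chains, mem_chains, Finset.mem_Icc]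
  constructor
  · rintro ⟨h, hm⟩
    exact ⟨h _, fun i => ⟨(h _).1, hm (Fin.le_last _)⟩,
      hm.comp (Fin.strictMono_castSucc).monotone⟩
  · rintro ⟨h, h', hm⟩
    refine ⟨fun i => ?_, fun i j hij => ?_⟩
    · induction i using Fin.lastCases with
      | last => exact h
      | cast i => exact ⟨(h' i).1, (h' i).2.trans h.2⟩
    · induction j using Fin.lastCases with
      | last =>
        induction i using Fin.lastCases with
        | last => exact le_rfl
        | cast i => exact (h' i).2
      | cast j =>
        induction i using Fin.lastCases with
        | last => exact absurd hij (not_le.2 (Fin.castSucc_lt_last j))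
        | cast i => exact hm (Fin.castSucc_le_castSucc_iff.1 hij)

lemma numDistinct_le {r : ℕ} (m : Fin r → ℕ) (q : ℕ) : numDistinct m q ≤ r + 1 := by
  refine (Finset.card_insert_le _ _).trans ?_
  have := Finset.card_image_le (s := Finset.univ) (f := m)
  rw [Finset.card_univ, Fintype.card_fin] at this
  omega

lemma numDistinct_succ {r q : ℕ} {m : Fin (r + 1) → ℕ} (hm : m ∈ chains (r + 1) q) :
    numDistinct m q =
      numDistinct (Fin.init m) (m (Fin.last r)) + if m (Fin.last r) = q then 0 else 1 := by
  classical
  have himage : Finset.univ.image m =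
      insert (m (Fin.last r)) (Finset.univ.image (Fin.init m)) := by
    ext x
    simp [Fin.exists_fin_succ', Fin.init, or_comm, eq_comm]
  rw [numDistinct, numDistinct, himage]
  split_ifs with h
  · rw [h, Finset.insert_idem, add_zero]
  · rw [Finset.card_insert_of_notMem]
    rw [← himage]
    intro hq
    obtain ⟨i, -, hi⟩ := Finset.mem_image.1 hq
    have h1 := (mem_chains.1 hm).2 (Fin.le_last i)
    have h2 := ((mem_chains.1 hm).1 (Fin.last r)).2
    omega

lemma chainSum_succ (t : ℝ) (r : ℕ) (e : Fin (r + 1) → ℕ) (q : ℕ) :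
    chainSum t (r + 1) e q = ∑ x ∈ Finset.Icc 1 q,
      (if x = q then t else 1) * chainSum t r (Fin.init e) x * ((x : ℝ) ^ e (Fin.last r))⁻¹ := by
  simp only [chainSum, Finset.mul_sum, Finset.sum_mul]
  rw [Finset.sum_sigma']
  refine Finset.sum_bij' (fun m _ => ⟨m (Fin.last r), Fin.init m⟩)
    (fun y _ => Fin.snoc (α := fun _ => ℕ) y.2 y.1) ?_ ?_ ?_ ?_ ?_
  · intro m hm
    rw [Finset.mem_sigma]
    exact mem_chains_succ.1 hm
  · rintro ⟨x, m⟩ hm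
    rw [Finset.mem_sigma] at hm
    rw [mem_chains_succ]
    simpa using hm
  · intro m _
    exact Fin.snoc_init_self m
  · rintro ⟨x, m⟩ _
    simp
  · intro m hm
    have h := numDistinct_le (Fin.init m) (m (Fin.last r))
    have hpow : t ^ (r + 1 + 1 - numDistinct m q) = (if m (Fin.last r) = q then t else 1) *
        t ^ (r + 1 - numDistinct (Fin.init m) (m (Fin.last r))) := by
      rw [numDistinct_succ hm]
      split_ifs
      · rw [add_zero, Nat.sub_add_comm h, pow_succ']
      · rw [Nat.add_sub_add_right, one_mul]
    rw [hpow, Fin.prod_univ_castSucc, div_eq_mul_inv, div_eq_mul_inv, mul_inv, mul_assoc, mul_assoc,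
      mul_assoc]
    rfl

lemma armSum_nil (t : ℝ) (q : ℕ) : armSum t [] q = 1 := by
  have h : chains 0 q = {Fin.elim0} := by
    ext m
    rw [mem_chains, Finset.mem_singleton]
    exact ⟨fun _ => Subsingleton.elim _ _, fun _ => ⟨fun i => i.elim0, fun i => i.elim0⟩⟩
  rw [armSum_eq_chainSum, chainSum]
  change ∑ m ∈ chains 0 q, _ = _
  rw [h, Finset.sum_singleton]
  simp [numDistinct]

/-- Splitting off the largest entry `x`: it costs a factor `t` exactly when it equals `q`. -/
lemma armSum_append_singleton (t : ℝ) (k : Index) (c : ℕ+) (q : ℕ) :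
    armSum t (k ++ [c]) q = ∑ x ∈ Finset.Icc 1 q,
      (if x = q then t else 1) * armSum t k x * ((x : ℝ) ^ (c : ℕ))⁻¹ := by
  rw [armSum_eq_chainSum, chainSum_cast t (r' := k.length + 1)
    (e' := Fin.snoc (α := fun _ => ℕ) (fun i => (k.get i : ℕ)) (c : ℕ)) (by simp), chainSum_succ]
  · simp only [Fin.init_snoc, Fin.snoc_last, armSum_eq_chainSum]
  · rintro ⟨i, hi⟩
    rw [List.length_append, List.length_singleton] at hi
    rcases Nat.lt_succ_iff_lt_or_eq.1 hi with h | rfl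
    · simp [Fin.snoc, h]
    · simp [Fin.snoc]

end Arm

/-! ### Generating function of one arm -/

section ArmSeries

open Filter Topology
open scoped MvPowerSeries.WithPiTopology

/-- A nonempty index is an index followed by a last entry. -/
lemma hasSum_index {f : Index → Series} {g : Series}
    (h : HasSum (fun p : Index × ℕ+ => f (p.1 ++ [p.2])) g) : HasSum f (f [] + g) := by
  have hinj : Function.Injective fun p : Index × ℕ+ => p.1 ++ [p.2] := by
    rintro ⟨k, c⟩ ⟨l, c'⟩ h
    obtain ⟨h1, h2⟩ := List.append_inj' h rfl
    simp_all
  refine HasSum.add_isCompl (s := {[]}) (t := Set.range fun p : Index × ℕ+ => p.1 ++ [p.2])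
    ?_ (hasSum_singleton [] f) (hinj.hasSum_range_iff.2 h)
  have hrange : (Set.range fun p : Index × ℕ+ => p.1 ++ [p.2]) = {[]}ᶜ := by
    ext k
    rcases List.eq_nil_or_concat k with rfl | ⟨l, c, rfl⟩
    · simp
    · simp
  rw [hrange]
  exact isCompl_compl

lemma hasSum_mul {ι κ : Type*} {f : ι → Series} {g : κ → Series} {s t : Series}
    (hf : HasSum f s) (hg : HasSum g t) (hfg : Summable fun x : ι × κ => f x.1 * g x.2) :
    HasSum (fun x : ι × κ => f x.1 * g x.2) (s * t) := hf.mul hg hfg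

lemma summable_monomial {ι : Type*} (e : ι → Fin 3 →₀ ℕ) (c : ι → ℝ)
    (h : ∀ d, {i | e i = d}.Finite) :
    Summable fun i => (MvPowerSeries.monomial (e i) (c i) : Series) := by
  classical
  rw [MvPowerSeries.WithPiTopology.summable_iff_summable_coeff]
  intro d
  refine summable_of_hasFiniteSupport ((h d).subset fun i hi => ?_)
  rw [Function.mem_support, MvPowerSeries.coeff_monomial] at hi
  exact ((ite_ne_right_iff.1 hi).1).symm

lemma C_mul_X_pow_mul_W_pow (c : ℝ) (i : Fin 3) (r w : ℕ) :
    MvPowerSeries.C c * MvPowerSeries.X i ^ r * W ^ w =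
      (MvPowerSeries.monomial (Finsupp.single i r + Finsupp.single 2 w) c : Series) := by
  rw [W, MvPowerSeries.X_pow_eq, MvPowerSeries.X_pow_eq, ← MvPowerSeries.monomial_zero_eq_C_apply,
    MvPowerSeries.monomial_mul_monomial, MvPowerSeries.monomial_mul_monomial]
  simp only [zero_add, mul_one]

/-- The summand of the generating function of one arm below the corner `q`; the depth is recorded
by the `i`-th indeterminate. -/
def armTerm (i : Fin 3) (t : ℝ) (q : ℕ) (k : Index) : Series :=
  MvPowerSeries.C (armSum t k q) * MvPowerSeries.X i ^ k.length * W ^ wt k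

/-- The generating function of one arm below the corner `q`. -/
def armSeries (i : Fin 3) (t : ℝ) (q : ℕ) : Series := ∑' k, armTerm i t q k

lemma hasSum_armTerm {i : Fin 3} (hi : i ≠ 2) (t : ℝ) (q : ℕ) :
    HasSum (armTerm i t q) (armSeries i t q) := by
  refine Summable.hasSum ?_
  have hterm : armTerm i t q = fun k => MvPowerSeries.monomial
      (Finsupp.single i k.length + Finsupp.single 2 (wt k)) (armSum t k q) :=
    funext fun k => C_mul_X_pow_mul_W_pow _ _ _ _
  rw [hterm]
  refine summable_monomial _ _ fun d => (finite_setOf_wt_le (d i) (d 2)).subset ?_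
  rintro k rfl
  simp [hi, hi.symm]

lemma wt_append_singleton (k : Index) (c : ℕ+) : wt (k ++ [c]) = wt k + c := by simp [wt]

lemma hasSum_pnat_pow {i : Fin 3} {m : ℕ} (hm : 1 ≤ m) :
    HasSum (fun c : ℕ+ => MvPowerSeries.C ((m : ℝ) ^ (c : ℕ))⁻¹ * MvPowerSeries.X i ^ 1 *
      W ^ (c : ℕ)) (MvPowerSeries.X i * W * ((m : Series) - W)⁻¹) := by
  have hm0 : (m : ℝ) ≠ 0 := by positivity
  rw [← Equiv.pnatEquivNat.symm.hasSum_iff]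
  have h := (hasSum_inv_C_sub hm0 (f := W) (by simp [W])).mul_left (MvPowerSeries.X i * W)
  rw [map_natCast] at h
  convert! h using 2 with n
  simp only [Function.comp_apply, Equiv.pnatEquivNat_symm_apply, Nat.succPNat_coe, inv_pow]
  rw [Nat.succ_eq_add_one, pow_succ W]
  ring

lemma armTerm_append_singleton (i : Fin 3) (t : ℝ) (q : ℕ) (k : Index) (c : ℕ+) :
    armTerm i t q (k ++ [c]) = ∑ m ∈ Finset.Icc 1 q,
      MvPowerSeries.C (if m = q then t else 1) * (armTerm i t m k *
        (MvPowerSeries.C ((m : ℝ) ^ (c : ℕ))⁻¹ * MvPowerSeries.X i ^ 1 * W ^ (c : ℕ))) := by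
  rw [armTerm, armSum_append_singleton, wt_append_singleton, map_sum, Finset.sum_mul,
    Finset.sum_mul, List.length_append, List.length_singleton]
  refine Finset.sum_congr rfl fun m _ => ?_
  rw [armTerm, map_mul, map_mul, pow_add, pow_add]
  ring

lemma hasSum_armTerm_mul {i : Fin 3} (hi : i ≠ 2) (t : ℝ) {m : ℕ} (hm : 1 ≤ m) :
    HasSum (fun p : Index × ℕ+ => armTerm i t m p.1 *
        (MvPowerSeries.C ((m : ℝ) ^ (p.2 : ℕ))⁻¹ * MvPowerSeries.X i ^ 1 * W ^ (p.2 : ℕ)))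
      (armSeries i t m * (MvPowerSeries.X i * W * ((m : Series) - W)⁻¹)) := by
  have hsum : Summable fun p : Index × ℕ+ => armTerm i t m p.1 *
      (MvPowerSeries.C ((m : ℝ) ^ (p.2 : ℕ))⁻¹ * MvPowerSeries.X i ^ 1 * W ^ (p.2 : ℕ)) := by
    simp only [armTerm, C_mul_X_pow_mul_W_pow, MvPowerSeries.monomial_mul_monomial]
    refine summable_monomial _ _ fun d => ((finite_setOf_wt_le (d i - 1) (d 2)).prod
      ((Set.finite_Iic (d 2)).preimage PNat.coe_injective.injOn)).subset ?_
    rintro ⟨k, c⟩ rfl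
    simp [hi, hi.symm]
  have h := hasSum_mul (hasSum_armTerm hi t m) (hasSum_pnat_pow (i := i) hm) hsum
  exact h

lemma armSeries_eq {i : Fin 3} (hi : i ≠ 2) (t : ℝ) (q : ℕ) :
    armSeries i t q = 1 + ∑ m ∈ Finset.Icc 1 q, MvPowerSeries.C (if m = q then t else 1) *
      (armSeries i t m * (MvPowerSeries.X i * W * ((m : Series) - W)⁻¹)) := by
  have h : HasSum (fun p : Index × ℕ+ => armTerm i t q (p.1 ++ [p.2]))
      (∑ m ∈ Finset.Icc 1 q, MvPowerSeries.C (if m = q then t else 1) *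
        (armSeries i t m * (MvPowerSeries.X i * W * ((m : Series) - W)⁻¹))) := by
    simp only [armTerm_append_singleton]
    exact hasSum_sum fun m hm =>
      (hasSum_armTerm_mul hi t (Finset.mem_Icc.1 hm).1).mul_left _
  have h0 : armTerm i t q [] = 1 := by simp [armTerm, armSum_nil, wt]
  rw [← h0]
  exact (hasSum_armTerm hi t q).unique (hasSum_index h)

/-- With `t = 1 / 2` the recursion for `armSeries` is solved by a product of linear factors. -/
lemma armSeries_half {i : Fin 3} (hi : i ≠ 2) {q : ℕ} (hq : 1 ≤ q) {a : Series}
    (ha : a = MvPowerSeries.C (1 / 2 : ℝ) * MvPowerSeries.X i * W) :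
    armSeries i (1 / 2) q = ((q : Series) - W) * ((q : Series) - W - a)⁻¹ *
      ∏ j ∈ Finset.Ico 1 q, ((j : Series) - W + a) * ((j : Series) - W - a)⁻¹ := by
  set E := armSeries i (1 / 2) with hE
  set u : ℕ → Series := fun m => MvPowerSeries.X i * W * ((m : Series) - W)⁻¹ with hu
  have hC : 2 * (MvPowerSeries.C (1 / 2 : ℝ) : Series) = 1 := by
    rw [two_mul, ← map_add]; norm_num
  have h2a : MvPowerSeries.X i * W = 2 * a := by
    rw [ha]; linear_combination (-(MvPowerSeries.X i * W)) * hC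
  have hinv : ∀ m : ℕ, 1 ≤ m → ((m : Series) - W) * ((m : Series) - W)⁻¹ = 1 := fun m hm => by
    have : (m : ℝ) ≠ 0 := by positivity
    exact MvPowerSeries.mul_inv_cancel _ (by simpa [W] using this)
  have hinv' : ∀ m : ℕ, 1 ≤ m → ((m : Series) - W - a) * ((m : Series) - W - a)⁻¹ = 1 :=
    fun m hm => by
      have : (m : ℝ) ≠ 0 := by positivity
      exact MvPowerSeries.mul_inv_cancel _ (by simpa [W, ha] using this)
  have hrec : ∀ m, 1 ≤ m → E m = 1 + ∑ j ∈ Finset.Ico 1 m, E j * u j +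
      MvPowerSeries.C (1 / 2 : ℝ) * (E m * u m) := by
    intro m hm
    conv_lhs => rw [hE, armSeries_eq hi]
    rw [← Finset.Ico_insert_right hm, Finset.sum_insert (by simp), if_pos rfl,
      Finset.sum_congr rfl fun j hj => by
        rw [if_neg (Finset.mem_Ico.1 hj).2.ne, map_one, one_mul]]
    ring
  -- The partial sum `1 + ∑ j < m, E j * u j` equals the product, and determines `E m`.
  have hsolve : ∀ m, 1 ≤ m → E m = ((m : Series) - W) * ((m : Series) - W - a)⁻¹ *
      (1 + ∑ j ∈ Finset.Ico 1 m, E j * u j) := by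
    intro m hm
    have h := hrec m hm
    simp only [hu, h2a] at h ⊢
    linear_combination (((m : Series) - W) * ((m : Series) - W - a)⁻¹) * h
      + (-E m) * hinv' m hm
      + (E m * a * ((m : Series) - W - a)⁻¹) * hinv m hm
      + (E m * a * ((m : Series) - W - a)⁻¹ * ((m : Series) - W) * ((m : Series) - W)⁻¹) * hC
  have hprod : ∀ m, 1 ≤ m → 1 + ∑ j ∈ Finset.Ico 1 m, E j * u j =
      ∏ j ∈ Finset.Ico 1 m, ((j : Series) - W + a) * ((j : Series) - W - a)⁻¹ := by
    intro m hm
    induction m, hm using Nat.le_induction with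
    | base => simp
    | succ m hm ih =>
      rw [Finset.sum_Ico_succ_top hm, Finset.prod_Ico_succ_top hm, ← add_assoc, ← ih]
      have h := hsolve m hm
      set S := 1 + ∑ j ∈ Finset.Ico 1 m, E j * u j
      rw [h]
      simp only [hu, h2a]
      linear_combination (-S) * hinv' m hm
        + (2 * a * ((m : Series) - W - a)⁻¹ * S) * hinv m hm
  rw [hsolve q hq, hprod q hq]

end ArmSeries

/-! ### The truncated generating function -/

section Truncated

open Filter Topology
open scoped MvPowerSeries.WithPiTopology

/-- The exponent of the monomial `term (k, l, a)`. -/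
def exponent (p : Index × Index × {a : ℕ // 2 ≤ a}) : Fin 3 →₀ ℕ :=
  Finsupp.single 0 p.1.length + Finsupp.single 1 p.2.1.length +
    Finsupp.single 2 (wt p.1 + (p.2.2 : ℕ) + wt p.2.1)

lemma finite_setOf_exponent_eq (d : Fin 3 →₀ ℕ) : {p | exponent p = d}.Finite := by
  have ha : {a : {a : ℕ // 2 ≤ a} | (a : ℕ) ≤ d 2}.Finite :=
    (Set.finite_Iic (d 2)).preimage Subtype.val_injective.injOn
  refine ((finite_setOf_wt_le (d 0) (d 2)).prod
    ((finite_setOf_wt_le (d 1) (d 2)).prod ha)).subset ?_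
  rintro ⟨k, l, a⟩ rfl
  simp [exponent]
  omega

/-- The generating function of the values `zetaTrunc (1 / 2) k l a N`. -/
def truncG (N : ℕ) : Series := fun d => ∑ p ∈ (finite_setOf_exponent_eq d).toFinset,
  ((2 : ℝ) ^ ((p.2.2 : ℕ) - 2) - 1) * zetaTrunc (1 / 2) p.1 p.2.1 p.2.2 N

lemma tendsto_truncG : Tendsto truncG atTop (𝓝 G) := by
  classical
  rw [MvPowerSeries.WithPiTopology.tendsto_iff_coeff_tendsto]
  intro d
  have hG : MvPowerSeries.coeff d G = ∑ p ∈ (finite_setOf_exponent_eq d).toFinset,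
      ((2 : ℝ) ^ ((p.2.2 : ℕ) - 2) - 1) * zeta (1 / 2) p.1 p.2.1 p.2.2 := by
    change ∑ᶠ p, MvPowerSeries.coeff d (term p) = _
    rw [finsum_eq_sum_of_support_subset (s := (finite_setOf_exponent_eq d).toFinset)]
    · refine Finset.sum_congr rfl fun p hp => ?_
      rw [Set.Finite.mem_toFinset] at hp
      rw [term_eq_monomial, MvPowerSeries.coeff_monomial]
      exact if_pos hp.symm
    · intro p hp
      rw [Function.mem_support, term_eq_monomial, MvPowerSeries.coeff_monomial] at hp
      rw [Set.Finite.coe_toFinset]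
      exact (ite_ne_right_iff.1 hp).1.symm
  rw [hG]
  exact tendsto_finsetSum _ fun p _ =>
    (tendsto_zetaTrunc (by norm_num) (by norm_num) p.1 p.2.1 p.2.2.2).const_mul _

lemma hasSum_truncG (N : ℕ) :
    HasSum (fun p => (MvPowerSeries.monomial (exponent p)
      (((2 : ℝ) ^ ((p.2.2 : ℕ) - 2) - 1) * zetaTrunc (1 / 2) p.1 p.2.1 p.2.2 N) : Series))
      (truncG N) := by
  classical
  rw [MvPowerSeries.WithPiTopology.hasSum_iff_hasSum_coeff]
  intro d
  simp only [MvPowerSeries.coeff_monomial]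
  have h : MvPowerSeries.coeff d (truncG N) = ∑ p ∈ (finite_setOf_exponent_eq d).toFinset,
      if d = exponent p then
        ((2 : ℝ) ^ ((p.2.2 : ℕ) - 2) - 1) * zetaTrunc (1 / 2) p.1 p.2.1 p.2.2 N else 0 := by
    refine Finset.sum_congr rfl fun p hp => ?_
    rw [Set.Finite.mem_toFinset] at hp
    rw [if_pos hp.symm]
  rw [h]
  refine hasSum_sum_of_ne_finset_zero fun p hp => if_neg ?_
  rintro rfl
  simp at hp

/-- The bijection `n ↦ n + 2` onto the admissible exponents of the corner. -/
def equivTwoLe : ℕ ≃ {a : ℕ // 2 ≤ a} where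
  toFun n := ⟨n + 2, by omega⟩
  invFun a := a - 2
  left_inv n := by simp
  right_inv a := Subtype.ext (by have := a.2; simp; omega)

/-- The summand of the generating function of the corner `q`. -/
def cornerTerm (q : ℕ) (a : {a : ℕ // 2 ≤ a}) : Series :=
  MvPowerSeries.C (((2 : ℝ) ^ ((a : ℕ) - 2) - 1) * (1 / (q : ℝ) ^ (a : ℕ))) * W ^ (a : ℕ)

lemma hasSum_cornerTerm {q : ℕ} (hq : 1 ≤ q) :
    HasSum (cornerTerm q)
      (W ^ 3 * (q : Series)⁻¹ * ((q : Series) - 2 * W)⁻¹ * ((q : Series) - W)⁻¹) := by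
  have hq0 : (q : ℝ) ≠ 0 := by positivity
  have h1 := hasSum_inv_C_sub hq0 (f := W) (by simp [W])
  have h2 := hasSum_inv_C_sub hq0 (f := 2 * W) (by simp [W])
  have h := (h2.sub h1).mul_left (W ^ 2 * MvPowerSeries.C (q : ℝ)⁻¹)
  have hinv1 := MvPowerSeries.mul_inv_cancel ((q : Series) - W) (by simpa [W] using hq0)
  have hinv2 := MvPowerSeries.mul_inv_cancel ((q : Series) - 2 * W) (by simpa [W] using hq0)
  have hval : W ^ 3 * (q : Series)⁻¹ * ((q : Series) - 2 * W)⁻¹ * ((q : Series) - W)⁻¹ =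
      W ^ 2 * MvPowerSeries.C (q : ℝ)⁻¹ * ((MvPowerSeries.C (q : ℝ) - 2 * W)⁻¹ -
        (MvPowerSeries.C (q : ℝ) - W)⁻¹) := by
    rw [← MvPowerSeries.C_inv, map_natCast]
    linear_combination (W ^ 2 * (q : Series)⁻¹ * ((q : Series) - 2 * W)⁻¹) * hinv1
      - (W ^ 2 * (q : Series)⁻¹ * ((q : Series) - W)⁻¹) * hinv2
  rw [hval, ← equivTwoLe.hasSum_iff]
  have hterm : cornerTerm q ∘ equivTwoLe = fun n => W ^ 2 * MvPowerSeries.C (q : ℝ)⁻¹ *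
      (MvPowerSeries.C ((q : ℝ)⁻¹ ^ (n + 1)) * (2 * W) ^ n -
        MvPowerSeries.C ((q : ℝ)⁻¹ ^ (n + 1)) * W ^ n) := by
    funext n
    have h2 : (2 : Series) = MvPowerSeries.C (2 : ℝ) := (map_ofNat _ 2).symm
    rw [mul_pow, h2, ← map_pow]
    simp only [Function.comp_apply, cornerTerm, equivTwoLe, Equiv.coe_fn_mk, Nat.add_sub_cancel]
    rw [one_div, ← inv_pow, map_mul, map_sub, map_one, pow_add W, pow_succ _ (n + 1), map_mul]
    ring
  rw [hterm]
  exact h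

lemma constantCoeff_half_mul {x : Series} :
    MvPowerSeries.constantCoeff (MvPowerSeries.C (1 / 2 : ℝ) * x * W) = 0 := by simp [W]

/-- The contribution of the corner `q` is the product of three generating functions. -/
lemma hasSum_corner {q : ℕ} (hq : 1 ≤ q) :
    HasSum (fun p => (MvPowerSeries.monomial (exponent p)
      (((2 : ℝ) ^ ((p.2.2 : ℕ) - 2) - 1) * (armSum (1 / 2) p.1 q * (1 / (q : ℝ) ^ (p.2.2 : ℕ)) *
        armSum (1 / 2) p.2.1 q)) : Series))
      (armSeries 0 (1 / 2) q * (armSeries 1 (1 / 2) q *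
        (W ^ 3 * (q : Series)⁻¹ * ((q : Series) - 2 * W)⁻¹ * ((q : Series) - W)⁻¹))) := by
  have hin : (fun y : Index × {a : ℕ // 2 ≤ a} =>
      armTerm 1 (1 / 2) q y.1 * cornerTerm q y.2) = fun y => MvPowerSeries.monomial
        (Finsupp.single 1 y.1.length + Finsupp.single 2 (wt y.1 + (y.2 : ℕ)))
        (armSum (1 / 2) y.1 q *
          (((2 : ℝ) ^ ((y.2 : ℕ) - 2) - 1) * (1 / (q : ℝ) ^ (y.2 : ℕ)))) := by
    funext y
    rw [← C_mul_X_pow_mul_W_pow, armTerm, cornerTerm, pow_add, map_mul _ (armSum (1 / 2) y.1 q)]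
    ring
  have hsum1 : Summable fun y : Index × {a : ℕ // 2 ≤ a} =>
      armTerm 1 (1 / 2) q y.1 * cornerTerm q y.2 := by
    rw [hin]
    refine summable_monomial _ _ fun d => ((finite_setOf_wt_le (d 1) (d 2)).prod
      ((Set.finite_Iic (d 2)).preimage Subtype.val_injective.injOn)).subset ?_
    rintro ⟨k, a⟩ rfl
    simp
  have hout : (fun p : Index × Index × {a : ℕ // 2 ≤ a} =>
      armTerm 0 (1 / 2) q p.1 * (armTerm 1 (1 / 2) q p.2.1 * cornerTerm q p.2.2)) =
      fun p => MvPowerSeries.monomial (exponent p)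
      (((2 : ℝ) ^ ((p.2.2 : ℕ) - 2) - 1) * (armSum (1 / 2) p.1 q * (1 / (q : ℝ) ^ (p.2.2 : ℕ)) *
        armSum (1 / 2) p.2.1 q)) := by
    funext p
    have h := congrFun hin p.2
    rw [h, armTerm, C_mul_X_pow_mul_W_pow, MvPowerSeries.monomial_mul_monomial]
    congr 1
    · congr 1
      rw [exponent, add_assoc (wt p.1), add_comm (p.2.2 : ℕ), Finsupp.single_add 2 (wt p.1)]
      abel
    · ring
  have hsum2 : Summable fun p : Index × Index × {a : ℕ // 2 ≤ a} =>
      armTerm 0 (1 / 2) q p.1 * (armTerm 1 (1 / 2) q p.2.1 * cornerTerm q p.2.2) := by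
    rw [hout]
    exact summable_monomial _ _ finite_setOf_exponent_eq
  have h1 := hasSum_mul (hasSum_armTerm (i := 1) (by decide) (1 / 2) q) (hasSum_cornerTerm hq) hsum1
  have h := hasSum_mul (hasSum_armTerm (i := 0) (by decide) (1 / 2) q) h1 hsum2
  rw [hout] at h
  exact h

lemma truncG_eq (N : ℕ) :
    truncG N = W ^ 3 * MvPowerSeries.C (1 / 2 : ℝ) * ∑ q ∈ Finset.Ico 1 (N + 1),
      wpTerm W (MvPowerSeries.C (1 / 2 : ℝ) * A * W) (MvPowerSeries.C (1 / 2 : ℝ) * B * W) 0 q := by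
  have hsum : HasSum (fun p => (MvPowerSeries.monomial (exponent p)
      (((2 : ℝ) ^ ((p.2.2 : ℕ) - 2) - 1) * zetaTrunc (1 / 2) p.1 p.2.1 p.2.2 N) : Series))
      (∑ q ∈ Finset.Ico 1 (N + 1), armSeries 0 (1 / 2) q * (armSeries 1 (1 / 2) q *
        (W ^ 3 * (q : Series)⁻¹ * ((q : Series) - 2 * W)⁻¹ * ((q : Series) - W)⁻¹))) := by
    have h := hasSum_sum fun q (hq : q ∈ Finset.Ico 1 (N + 1)) =>
      hasSum_corner (Finset.mem_Ico.1 hq).1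
    have hterm : (fun p : Index × Index × {a : ℕ // 2 ≤ a} => (MvPowerSeries.monomial (exponent p)
        (((2 : ℝ) ^ ((p.2.2 : ℕ) - 2) - 1) * zetaTrunc (1 / 2) p.1 p.2.1 p.2.2 N) : Series)) =
        fun p => ∑ q ∈ Finset.Ico 1 (N + 1), MvPowerSeries.monomial (exponent p)
          (((2 : ℝ) ^ ((p.2.2 : ℕ) - 2) - 1) * (armSum (1 / 2) p.1 q *
            (1 / (q : ℝ) ^ (p.2.2 : ℕ)) * armSum (1 / 2) p.2.1 q)) := by
      funext p
      rw [← map_sum, ← Finset.mul_sum, zetaTrunc_eq, show (1 : ℝ) - 1 / 2 = 1 / 2 by norm_num]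
      rfl
    rw [hterm]
    exact h
  rw [(hasSum_truncG N).unique hsum, Finset.mul_sum]
  refine Finset.sum_congr rfl fun q hq => ?_
  have hq1 := (Finset.mem_Ico.1 hq).1
  have hq0 : (q : ℝ) ≠ 0 := by positivity
  have hC : 2 * (MvPowerSeries.C (1 / 2 : ℝ) : Series) = 1 := by
    rw [two_mul, ← map_add]; norm_num
  have hinv := MvPowerSeries.mul_inv_cancel ((q : Series) - W) (by simpa [W] using hq0)
  have hA := armSeries_half (i := 0) (by decide) hq1
    (a := MvPowerSeries.C (1 / 2 : ℝ) * A * W) rfl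
  have hB := armSeries_half (i := 1) (by decide) hq1
    (a := MvPowerSeries.C (1 / 2 : ℝ) * B * W) rfl
  rw [hA, hB]
  set a := MvPowerSeries.C (1 / 2 : ℝ) * A * W
  set b := MvPowerSeries.C (1 / 2 : ℝ) * B * W
  have hP : wpProd W a b 0 q =
      (∏ j ∈ Finset.Ico 1 q, ((j : Series) - W + a) * ((j : Series) - W - a)⁻¹) *
        ∏ j ∈ Finset.Ico 1 q, ((j : Series) - W + b) * ((j : Series) - W - b)⁻¹ := by
    rw [wpProd, ← Finset.prod_mul_distrib]
    refine Finset.prod_congr rfl fun j _ => ?_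
    rw [Nat.cast_zero, add_zero]
    ring
  have hT : wpTerm W a b 0 q = (2 * (q : Series) - 2 * W) * (q : Series)⁻¹ *
      ((q : Series) - 2 * W)⁻¹ * ((q : Series) - W - a)⁻¹ * ((q : Series) - W - b)⁻¹ *
        wpProd W a b 0 q := by
    rw [wpTerm, Nat.cast_zero, add_zero, add_zero]
  rw [hT, hP]
  set P := ∏ j ∈ Finset.Ico 1 q, ((j : Series) - W + a) * ((j : Series) - W - a)⁻¹
  set Q := ∏ j ∈ Finset.Ico 1 q, ((j : Series) - W + b) * ((j : Series) - W - b)⁻¹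
  set Z := W ^ 3 * (q : Series)⁻¹ * ((q : Series) - 2 * W)⁻¹ * ((q : Series) - W - a)⁻¹ *
    ((q : Series) - W - b)⁻¹ * P * Q * ((q : Series) - W) with hZ
  linear_combination Z * hinv - Z * hC

lemma mul_wpCert_one_eq (s : ℕ) :
    W ^ 3 * MvPowerSeries.C (1 / 2 : ℝ) * wpCert W (MvPowerSeries.C (1 / 2 : ℝ) * A * W)
      (MvPowerSeries.C (1 / 2 : ℝ) * B * W) s 1 =
    W * (2 * (1 - MvPowerSeries.C (1 / 2 : ℝ) * A) * (1 - MvPowerSeries.C (1 / 2 : ℝ) * B))⁻¹ *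
      ((((s : Series) + 1 - 2 * W)⁻¹ - ((s : Series) + 1)⁻¹) +
        (((s : Series) + 1 - MvPowerSeries.C (1 / 2 : ℝ) * (A + B) * W)⁻¹ -
          ((s : Series) + 1)⁻¹) -
        (((s : Series) + 1 - (1 + MvPowerSeries.C (1 / 2 : ℝ) * A) * W)⁻¹ -
          ((s : Series) + 1)⁻¹) -
        (((s : Series) + 1 - (1 + MvPowerSeries.C (1 / 2 : ℝ) * B) * W)⁻¹ -
          ((s : Series) + 1)⁻¹)) := by
  have h := mul_wpCert_one_series (w := W) (a := MvPowerSeries.C (1 / 2 : ℝ) * A * W)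
    (b := MvPowerSeries.C (1 / 2 : ℝ) * B * W) (by simp [W]) constantCoeff_half_mul
    constantCoeff_half_mul s
  set c := wpCert W (MvPowerSeries.C (1 / 2 : ℝ) * A * W) (MvPowerSeries.C (1 / 2 : ℝ) * B * W) s 1
  have h1 : (s : Series) + 1 - MvPowerSeries.C (1 / 2 : ℝ) * (A + B) * W =
      (s : Series) + 1 - MvPowerSeries.C (1 / 2 : ℝ) * A * W -
        MvPowerSeries.C (1 / 2 : ℝ) * B * W := by ring
  have h2 : ∀ X : Series, (s : Series) + 1 - (1 + MvPowerSeries.C (1 / 2 : ℝ) * X) * W =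
      (s : Series) + 1 - W - MvPowerSeries.C (1 / 2 : ℝ) * X * W := fun X => by ring
  rw [h1, h2 A, h2 B]
  have hC : 2 * (MvPowerSeries.C (1 / 2 : ℝ) : Series) = 1 := by
    rw [two_mul, ← map_add]; norm_num
  have h2c : MvPowerSeries.constantCoeff (2 : Series) = 2 := map_ofNat _ 2
  have hinv := MvPowerSeries.mul_inv_cancel
    (2 * (1 - MvPowerSeries.C (1 / 2 : ℝ) * A) * (1 - MvPowerSeries.C (1 / 2 : ℝ) * B))
    (by simp [A, B, h2c])
  set V := (2 * (1 - MvPowerSeries.C (1 / 2 : ℝ) * A) * (1 - MvPowerSeries.C (1 / 2 : ℝ) * B))⁻¹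
  linear_combination (W * V) * h - (W ^ 3 * MvPowerSeries.C (1 / 2 : ℝ) * c) * hinv +
    (W ^ 3 * c * V * (1 - MvPowerSeries.C (1 / 2 : ℝ) * A) *
      (1 - MvPowerSeries.C (1 / 2 : ℝ) * B)) * hC

lemma truncNorm_half_mul_le {D : Fin 3 →₀ ℕ} {x : Series} (hx : truncNorm D x ≤ 1) :
    truncNorm D (MvPowerSeries.C (1 / 2 : ℝ) * x * W) ≤ 1 / 80 := by
  refine (truncNorm_mul_le_of_le (truncNorm_mul_le_of_le (truncNorm_C_le _) hx)
    truncNorm_W_le).trans ?_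
  rw [abs_of_pos (by norm_num)]
  norm_num

lemma G_eq :
    G = W * (2 * (1 - MvPowerSeries.C (1 / 2 : ℝ) * A) *
          (1 - MvPowerSeries.C (1 / 2 : ℝ) * B))⁻¹ *
        (psiOneAt (2 * W) + psiOneAt (MvPowerSeries.C (1 / 2 : ℝ) * (A + B) * W)
          - psiOneAt ((1 + MvPowerSeries.C (1 / 2 : ℝ) * A) * W)
          - psiOneAt ((1 + MvPowerSeries.C (1 / 2 : ℝ) * B) * W)) := by
  have hrem := tendsto_sum_wpTerm_sub (w := W) (a := MvPowerSeries.C (1 / 2 : ℝ) * A * W)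
    (b := MvPowerSeries.C (1 / 2 : ℝ) * B * W) (by simp [W]) constantCoeff_half_mul
    constantCoeff_half_mul (fun _ => truncNorm_W_le)
    (fun _ => truncNorm_half_mul_le truncNorm_A_le) fun _ => truncNorm_half_mul_le truncNorm_B_le
  have hpsi := ((((tendsto_sum_inv_sub (f := 2 * W) (by simp [W])).add
    (tendsto_sum_inv_sub (f := MvPowerSeries.C (1 / 2 : ℝ) * (A + B) * W)
      constantCoeff_half_mul)).sub
    (tendsto_sum_inv_sub (f := (1 + MvPowerSeries.C (1 / 2 : ℝ) * A) * W) (by simp [W]))).sub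
    (tendsto_sum_inv_sub (f := (1 + MvPowerSeries.C (1 / 2 : ℝ) * B) * W) (by simp [W]))).const_mul
    (W * (2 * (1 - MvPowerSeries.C (1 / 2 : ℝ) * A) *
          (1 - MvPowerSeries.C (1 / 2 : ℝ) * B))⁻¹)
  have h := (hrem.const_mul (W ^ 3 * MvPowerSeries.C (1 / 2 : ℝ))).add hpsi
  rw [mul_zero, zero_add] at h
  refine tendsto_nhds_unique tendsto_truncG (h.congr fun N => ?_)
  rw [truncG_eq, ← Finset.sum_add_distrib, ← Finset.sum_sub_distrib, ← Finset.sum_sub_distrib,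
    Finset.mul_sum _ _ (W * _), ← Finset.sum_congr rfl fun s _ => mul_wpCert_one_eq s,
    ← Finset.mul_sum]
  ring

end Truncated

end AntiHook

end

theorem proposition3p3 :
    (∀ (k l : AntiHook.Index) (a : ℕ), 2 ≤ a →
      Filter.Tendsto (AntiHook.zetaTrunc (1 / 2) k l a) Filter.atTop
        (nhds (AntiHook.zeta (1 / 2) k l a))) ∧
    AntiHook.G =
      AntiHook.W *
        (2 * (1 - MvPowerSeries.C (1 / 2 : ℝ) * AntiHook.A) *
          (1 - MvPowerSeries.C (1 / 2 : ℝ) * AntiHook.B))⁻¹ *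
        (AntiHook.psiOneAt (2 * AntiHook.W)
          + AntiHook.psiOneAt
              (MvPowerSeries.C (1 / 2 : ℝ) * (AntiHook.A + AntiHook.B) * AntiHook.W)
          - AntiHook.psiOneAt ((1 + MvPowerSeries.C (1 / 2 : ℝ) * AntiHook.A) * AntiHook.W)
          - AntiHook.psiOneAt ((1 + MvPowerSeries.C (1 / 2 : ℝ) * AntiHook.B) * AntiHook.W)) :=
  ⟨fun k l _ ha => AntiHook.tendsto_zetaTrunc (by norm_num) (by norm_num) k l ha, AntiHook.G_eq⟩
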